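/- For $\gamma\in\mathbb{R}$ let $\mathcal{D}_\gamma(\mathbb{R}^3)^3$ be the set of smooth, compactly supported vector fields $\boldsymbol u:\mathbb{R}^3\to\mathbb{R}^3$ such that, in case $\gamma\le-\frac12$, $\boldsymbol u(\boldsymbol 0)=\boldsymbol 0$. Use spherical coordinates $\boldsymbol x=\rho\,\boldsymbol\sigma$ with $\boldsymbol\sigma=(\cos\theta,\ \sin\theta\cos\varphi,\ \sin\theta\sin\varphi)$, $\rho\geq 0$, $\theta\in[0,\pi]$, $\varphi\in[0,2\pi)$, and put $\boldsymbol e_\varphi=(0,-\sin\varphi,\cos\varphi)$. The swirl component of $\boldsymbol u$ is $u_\varphi(\rho,\theta,\varphi)=\boldsymbol u(\rho\boldsymbol\sigma)\cdot\boldsymbol e_\varphi$. Define $$C_\gamma=\begin{cases}\left(\gamma+\frac12\right)^2\,\dfrac{4+\left(\gamma-\frac32\right)^2}{2+\left(\gamma-\frac32\right)^2}, & \gamma\le 1,\\[2ex] \left(\gamma+\frac12\right)^2+2, & \gamma>1.\end{cases}$$ Let $\gamma\in\mathbb{R}$ and let $\boldsymbol u\in\mathcal{D}_\gamma(\mathbb{R}^3)^3$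 be solenoidal, i.e. $\operatorname{div}\boldsymbol u=0$. Assume that the swirl component $u_\varphi$ is independent of $\varphi$ (nothing is assumed about the dependence on $\varphi$ of the other components of $\boldsymbol u$). Then $$C_\gamma\int_{\mathbb{R}^3}\frac{|\boldsymbol u|^2}{|\boldsymbol x|^2}\,|\boldsymbol x|^{2\gamma}\,dx\ \le\ \int_{\mathbb{R}^3}|\nabla\boldsymbol u|^2\,|\boldsymbol x|^{2\gamma}\,dx ,$$ where $|\nabla\boldsymbol u|^2=\sum_{i,j=1}^3(\partial u_j/\partial x_i)^2$ and both integrals take values in $[0,\infty]$. -/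

import Mathlib

open MeasureTheory
open scoped ContDiff

namespace HardyLeray

/-- Euclidean space `ℝ^N`, with the Euclidean norm. -/
abbrev Space (N : ℕ) : Type := EuclideanSpace ℝ (Fin N)

/-- The class `D_γ(ℝ^N)^N`: smooth compactly supported vector fields `u : ℝ^N → ℝ^N`,
with `u 0 = 0` in case `γ ≤ 1 - N/2`. -/
structure IsTestField (N : ℕ) (γ : ℝ) (u : Space N → Space N) : Prop where
  smooth : ContDiff ℝ ∞ u
  compactSupport : HasCompactSupport u
  zero_at_origin : γ ≤ 1 - (N : ℝ) / 2 → u 0 = 0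

/-- The partial derivative `∂u/∂x_i` at `x` of a vector field. -/
noncomputable def partialDeriv {N : ℕ} (i : Fin N) (u : Space N → Space N) (x : Space N) :
    Space N :=
  fderiv ℝ u x (EuclideanSpace.single i 1)

/-- The divergence `∑ i, ∂u_i/∂x_i`. -/
noncomputable def divergence {N : ℕ} (u : Space N → Space N) (x : Space N) : ℝ :=
  ∑ i, partialDeriv i u x i

/-- `u` is solenoidal, i.e. divergence-free. -/
def IsSolenoidal {N : ℕ} (u : Space N → Space N) : Prop :=
  ∀ x, divergence u x = 0

/-- `|∇u|² = ∑ i, ∑ j, (∂u_j/∂x_i)²`. -/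
noncomputable def gradNormSq {N : ℕ} (u : Space N → Space N) (x : Space N) : ℝ :=
  ∑ i, ∑ j, (partialDeriv i u x j) ^ 2

/-- The point `σ = (cos θ, sin θ cos φ, sin θ sin φ)` of the unit sphere; the polar axis is the
first coordinate axis. -/
noncomputable def sphericalPoint (θ φ : ℝ) : Space 3 :=
  !₂[Real.cos θ, Real.sin θ * Real.cos φ, Real.sin θ * Real.sin φ]

/-- The azimuthal frame vector `e_φ = (0, -sin φ, cos φ)`. -/
noncomputable def azimuthalVector (φ : ℝ) : Space 3 :=
  !₂[0, -Real.sin φ, Real.cos φ]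

/-- The swirl component `u_φ` at the point `x = ρ σ(θ, φ)`: the coefficient of `e_φ` in the
expansion of `u x` in the orthonormal frame `(σ, e_θ, e_φ)`. -/
noncomputable def swirlComponent (u : Space 3 → Space 3) (ρ θ φ : ℝ) : ℝ :=
  inner ℝ (u (ρ • sphericalPoint θ φ)) (azimuthalVector φ)

/-- The swirl component is independent of `φ`. Only points off the polar axis, where the frame is
determined by the point, are concerned. -/
def HasAxisymmetricSwirl (u : Space 3 → Space 3) : Prop :=
  ∀ ρ θ φ₁ φ₂ : ℝ, 0 < ρ → θ ∈ Set.Ioo 0 Real.pi →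
    φ₁ ∈ Set.Ico 0 (2 * Real.pi) → φ₂ ∈ Set.Ico 0 (2 * Real.pi) →
    swirlComponent u ρ θ φ₁ = swirlComponent u ρ θ φ₂

/-- The Costin–Maz'ya constant `C_γ` in dimension three. -/
noncomputable def costinMazyaConst (γ : ℝ) : ℝ :=
  if γ ≤ 1 then (γ + 1 / 2) ^ 2 * ((4 + (γ - 3 / 2) ^ 2) / (2 + (γ - 3 / 2) ^ 2))
  else (γ + 1 / 2) ^ 2 + 2

end HardyLeray

namespace HardyLeray
open Real intervalIntegral Set Filter Topology
open scoped ENNReal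

/-! Write `a = γ + 1/2` and `f`, `w`, `h` for the components of `u` along `σ`, `e_θ`, `e_φ`. As `h`
does not depend on `φ`, the azimuthal derivative drops out of the divergence, and on each meridian
half-plane `∂_ρ(ρ² f) sin θ + ρ ∂_θ(w sin θ) = 0`. Hence `f` has mean zero against `sin θ` along
every meridian (`integral_radialComponent_mul_sin`), so the zonal spectral gap 2
(`integral_sq_mul_sin_le`) applies to `f` although `f` may depend on `φ`. Moreover `D = ∂_θ w + cot
θ w` equals `-(ρ ∂_ρ f + 2f)`, which trades angular derivatives of `w` for radial derivatives of
`f`.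

On a sphere, the Dirichlet integrand is bounded below by a form in the components and their radial
derivatives, plus `θ`- and `φ`-derivatives that integrate to zero (`sphere_energy_algebra`,
`integral_sphereForm_le`). A parameter `κ ∈ [0,1]` enters here: up to a `θ`-derivative, `κ D² sin θ`
equals `κ (∂_θ w - cot θ w)² sin θ + 2κ w² sin θ`; the square is dropped and the remaining `(1 - κ)
D²` is expressed through `f`.

Along rays, completing squares against the weight `ρ^(2a-1)` yields the factor `a² + 2κ` for all
three components (`integral_norm_sq_le_sphereForm`), provided `κ (2 + (a - 2)²) ≤ a²`. The constant
`C_γ` is `a² + 2κ` for the largest admissible `κ`; the bound `κ ≤ 1` becomes the binding one when `a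
> 3/2`, i.e. `γ > 1`.

All this is done on `ε ≤ |x| ≤ R`; the boundary term at `ε` disappears as `ε → 0` by
`tendsto_boundary`. -/

/-! ### One-dimensional inequalities: zonal spectral gap and weighted radial bounds. -/

/-- Half of the spectral gap for zonal functions: the function vanishes on the equator. -/
theorem integral_sq_mul_sin_le_half {k k' : ℝ → ℝ} (hk : ∀ θ, HasDerivAt k (k' θ) θ)
    (hk' : Continuous k') (h0 : k (π / 2) = 0) :
    2 * ∫ θ in (0)..(π / 2), k θ ^ 2 * sin θ ≤ ∫ θ in (0)..(π / 2), k' θ ^ 2 * sin θ := by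
  have hkc : Continuous k := continuous_iff_continuousAt.2 fun θ => (hk θ).continuousAt
  have hpos : (0 : ℝ) ≤ π / 2 := by positivity
  have hcos : ∀ θ ∈ Ico 0 (π / 2), 0 < cos θ := fun θ hθ =>
    cos_pos_of_mem_Ioo ⟨by linarith [hθ.1, pi_pos], hθ.2⟩
  -- Since `k` vanishes at `π / 2` and `cos` has a simple zero there, the quotient tends to 0, which
  -- is also its value under division by zero. Hence no boundary term arises at the equator.
  have hlim : ContinuousAt (fun θ => k θ ^ 2 / cos θ) (π / 2) := by
    rw [continuousAt_iff_punctured_nhds]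
    have h1 : Tendsto (slope k (π / 2)) (𝓝[≠] (π / 2)) (𝓝 (k' (π / 2))) :=
      (hk (π / 2)).tendsto_slope
    have h2 : Tendsto (slope cos (π / 2)) (𝓝[≠] (π / 2)) (𝓝 (-1)) := by
      simpa using (hasDerivAt_cos (π / 2)).tendsto_slope
    have h3 : Tendsto k (𝓝[≠] (π / 2)) (𝓝 0) := by
      rw [← h0]; exact (hkc.tendsto _).mono_left nhdsWithin_le_nhds
    have h4 := h3.mul (h1.div h2 (by norm_num))
    simp only [zero_mul] at h4
    simp only [cos_pi_div_two, div_zero]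
    refine h4.congr' ?_
    filter_upwards [self_mem_nhdsWithin] with θ hθ
    have hne : θ - π / 2 ≠ 0 := sub_ne_zero.2 hθ
    simp only [Pi.div_apply, slope_def_field, h0, cos_pi_div_two, sub_zero]
    rw [div_div_div_cancel_right₀ hne, sq, mul_div_assoc]
  have hcont : ContinuousOn (fun θ => -(k θ ^ 2 / cos θ * sin θ ^ 2)) (Icc 0 (π / 2)) := by
    intro θ hθ
    have hc : ContinuousAt (fun θ => k θ ^ 2 / cos θ) θ := by
      rcases hθ.2.eq_or_lt with h | h
      · rw [h]; exact hlim
      · exact (hkc.pow 2).continuousAt.div continuous_cos.continuousAt (hcos θ ⟨hθ.1, h⟩).ne'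
    exact ((hc.mul (continuous_sin.pow 2).continuousAt).neg).continuousWithinAt
  -- The first zonal eigenfunction is `cos θ`, with logarithmic derivative `-tan θ`. Completing the
  -- square around it gives `(k'² - 2k²) sin θ = (k' + k tan θ)² sin θ - (k² sin² θ / cos θ)'`.
  have key := sub_le_integral_of_hasDeriv_right_of_le hpos hcont
    (g' := fun θ => -((2 * k θ * k' θ * cos θ + k θ ^ 2 * sin θ) / cos θ ^ 2 * sin θ ^ 2
      + k θ ^ 2 / cos θ * (2 * sin θ * cos θ)))
    (φ := fun θ => k' θ ^ 2 * sin θ - 2 * (k θ ^ 2 * sin θ))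
    (fun θ hθ => by
      have hc := (hcos θ ⟨hθ.1.le, hθ.2⟩).ne'
      have h := (((hk θ).pow 2).div (hasDerivAt_cos θ) hc).mul ((hasDerivAt_sin θ).pow 2)
      refine (h.neg.congr_deriv ?_).hasDerivWithinAt
      simp)
    ((by fun_prop : Continuous fun θ => k' θ ^ 2 * sin θ - 2 * (k θ ^ 2 * sin θ)).integrableOn_Icc)
    (fun θ hθ => by
      have hc := hcos θ ⟨hθ.1.le, hθ.2⟩
      have hs : 0 ≤ sin θ := sin_nonneg_of_nonneg_of_le_pi hθ.1.le (by linarith [hθ.2, pi_pos])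
      have hsq : 0 ≤ (k' θ + k θ * sin θ / cos θ) ^ 2 * sin θ := by positivity
      have : k' θ ^ 2 * sin θ - 2 * (k θ ^ 2 * sin θ)
          - -((2 * k θ * k' θ * cos θ + k θ ^ 2 * sin θ) / cos θ ^ 2 * sin θ ^ 2
          + k θ ^ 2 / cos θ * (2 * sin θ * cos θ))
          = (k' θ + k θ * sin θ / cos θ) ^ 2 * sin θ := by
        field_simp
        ring
      linarith)
  rw [intervalIntegral.integral_sub (Continuous.intervalIntegrable (by fun_prop) _ _)
    (Continuous.intervalIntegrable (by fun_prop) _ _), intervalIntegral.integral_const_mul] at key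
  simp [h0] at key
  linarith

/-- The spectral gap for zonal functions of mean zero on the sphere. -/
theorem integral_sq_mul_sin_le {f f' : ℝ → ℝ} (hf : ∀ θ, HasDerivAt f (f' θ) θ)
    (hf' : Continuous f') (h0 : ∫ θ in (0)..π, f θ * sin θ = 0) :
    2 * ∫ θ in (0)..π, f θ ^ 2 * sin θ ≤ ∫ θ in (0)..π, f' θ ^ 2 * sin θ := by
  have hfc : Continuous f := continuous_iff_continuousAt.2 fun θ => (hf θ).continuousAt
  -- Subtracting the equatorial value makes the half-interval inequality available on both
  -- hemispheres, the southern one by `θ ↦ π - θ`.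
  set c := f (π / 2) with hc
  have h1 := integral_sq_mul_sin_le_half (k := fun θ => f θ - c) (k' := f')
    (fun θ => (hf θ).sub_const c) hf' (by simp [hc])
  have h2 := integral_sq_mul_sin_le_half (k := fun θ => f (π - θ) - c)
    (k' := fun θ => -f' (π - θ))
    (fun θ => by
      have := (hf (π - θ)).comp θ ((hasDerivAt_id θ).const_sub π)
      simpa [Function.comp_def] using this.sub_const c)
    (by fun_prop) (by simp only [hc, sub_eq_zero]; congr 1; ring)
  have e1 : ∫ θ in (0)..(π / 2), (f (π - θ) - c) ^ 2 * sin θ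
      = ∫ θ in (π / 2)..π, (f θ - c) ^ 2 * sin θ := by
    have := intervalIntegral.integral_comp_sub_left
      (a := 0) (b := π / 2) (fun θ => (f θ - c) ^ 2 * sin θ) π
    simp only [sin_pi_sub] at this
    rw [this]; congr 1 <;> ring
  have e2 : ∫ θ in (0)..(π / 2), (-f' (π - θ)) ^ 2 * sin θ
      = ∫ θ in (π / 2)..π, f' θ ^ 2 * sin θ := by
    have := intervalIntegral.integral_comp_sub_left
      (a := 0) (b := π / 2) (fun θ => f' θ ^ 2 * sin θ) π
    simp only [sin_pi_sub] at this
    simp only [neg_sq]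
    rw [this]; congr 1 <;> ring
  rw [e1, e2] at h2
  have s1 := intervalIntegral.integral_add_adjacent_intervals (μ := volume)
    (f := fun θ => (f θ - c) ^ 2 * sin θ) (a := 0) (b := π / 2) (c := π)
    (Continuous.intervalIntegrable (by fun_prop) _ _)
    (Continuous.intervalIntegrable (by fun_prop) _ _)
  have s2 := intervalIntegral.integral_add_adjacent_intervals (μ := volume)
    (f := fun θ => f' θ ^ 2 * sin θ) (a := 0) (b := π / 2) (c := π)
    (Continuous.intervalIntegrable (by fun_prop) _ _)
    (Continuous.intervalIntegrable (by fun_prop) _ _)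
  -- The cross term vanishes by the mean-zero condition, so the shift by `c` only increases the
  -- left-hand side.
  have s3 : ∫ θ in (0)..π, (f θ - c) ^ 2 * sin θ
      = (∫ θ in (0)..π, f θ ^ 2 * sin θ) + 2 * c ^ 2 := by
    have : ∀ θ, (f θ - c) ^ 2 * sin θ
        = f θ ^ 2 * sin θ - 2 * c * (f θ * sin θ) + c ^ 2 * sin θ := fun θ => by ring
    simp only [this]
    rw [intervalIntegral.integral_add (Continuous.intervalIntegrable (by fun_prop) _ _)
      (Continuous.intervalIntegrable (by fun_prop) _ _),
      intervalIntegral.integral_sub (Continuous.intervalIntegrable (by fun_prop) _ _)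
      (Continuous.intervalIntegrable (by fun_prop) _ _),
      intervalIntegral.integral_const_mul, intervalIntegral.integral_const_mul, h0, integral_sin]
    simp
    ring
  nlinarith [sq_nonneg c]

/-- A weighted integral which dominates a multiple of the derivative of `ρ ^ (2a) g²`. -/
theorem neg_boundary_le_integral_rpow {g g' q : ℝ → ℝ} (hg : ∀ ρ, HasDerivAt g (g' ρ) ρ)
    (hq : Continuous q) {a c ε R : ℝ} (hε : 0 < ε) (hεR : ε ≤ R) (hR : g R = 0)
    (hle : ∀ ρ, c * (2 * a * g ρ ^ 2 + 2 * ρ * g ρ * g' ρ) ≤ q ρ) :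
    -(c * (ε ^ (2 * a) * g ε ^ 2)) ≤ ∫ ρ in ε..R, ρ ^ (2 * a - 1) * q ρ := by
  have hpos : ∀ ρ ∈ Icc ε R, 0 < ρ := fun ρ hρ => hε.trans_le hρ.1
  have hw : ContinuousOn (fun ρ : ℝ => ρ ^ (2 * a - 1)) (Icc ε R) := fun ρ hρ =>
    (continuousAt_rpow_const _ _ (Or.inl (hpos ρ hρ).ne')).continuousWithinAt
  have hd : ∀ ρ ∈ Icc ε R, HasDerivAt (fun ρ => c * (ρ ^ (2 * a) * g ρ ^ 2))
      (ρ ^ (2 * a - 1) * (c * (2 * a * g ρ ^ 2 + 2 * ρ * g ρ * g' ρ))) ρ := by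
    intro ρ hρ
    have hρ0 := hpos ρ hρ
    have h := (((hasDerivAt_rpow_const (p := 2 * a) (Or.inl hρ0.ne')).mul
      ((hg ρ).pow 2)).const_mul c)
    refine h.congr_deriv ?_
    have : ρ ^ (2 * a) = ρ ^ (2 * a - 1) * ρ := by
      rw [rpow_sub_one hρ0.ne']; field_simp
    rw [this]
    simp
    ring
  have key := sub_le_integral_of_hasDeriv_right_of_le hεR
    (fun ρ hρ => (hd ρ hρ).continuousAt.continuousWithinAt)
    (fun ρ hρ => (hd ρ (Ioo_subset_Icc_self hρ)).hasDerivWithinAt)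
    (φ := fun ρ => ρ ^ (2 * a - 1) * q ρ)
    ((hw.mul hq.continuousOn).integrableOn_Icc)
    (fun ρ hρ => mul_le_mul_of_nonneg_left (hle ρ)
      (rpow_nonneg (hpos ρ (Ioo_subset_Icc_self hρ)).le _))
  simpa [hR] using key

/-! ### Integration in spherical coordinates. -/

@[fun_prop]
theorem continuous_vec3 {X : Type*} [TopologicalSpace X] {a b c : X → ℝ} (ha : Continuous a)
    (hb : Continuous b) (hc : Continuous c) :
    Continuous fun x => (!₂[a x, b x, c x] : Space 3) := by
  refine (PiLp.continuous_toLp 2 _).comp (continuous_pi fun i => ?_)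
  fin_cases i <;> assumption

@[fun_prop]
theorem continuous_sphericalPoint {X : Type*} [TopologicalSpace X] {θ φ : X → ℝ}
    (hθ : Continuous θ) (hφ : Continuous φ) : Continuous fun x => sphericalPoint (θ x) (φ x) := by
  unfold sphericalPoint
  fun_prop

/-- Lebesgue measure on `Space 3` in Cartesian coordinates. -/
theorem lintegral_space3 (F : Space 3 → ℝ≥0∞) (hF : Measurable F) :
    ∫⁻ x, F x = ∫⁻ x₁ : ℝ, ∫⁻ p : ℝ × ℝ, F !₂[x₁, p.1, p.2] := by
  have m1 := PiLp.volume_preserving_toLp (Fin 3)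
  have m2 := (volume_preserving_piFinSuccAbove (fun _ : Fin 3 => ℝ) 0).symm
  have m3 := (volume_preserving_finTwoArrow ℝ).symm
  rw [← m1.lintegral_comp hF]
  have hF1 : Measurable fun x : Fin 3 → ℝ => F (WithLp.toLp 2 x) := hF.comp m1.measurable
  have hF3 : Measurable fun p : ℝ × (Fin 2 → ℝ) => F (WithLp.toLp 2
      ((MeasurableEquiv.piFinSuccAbove (fun _ : Fin 3 => ℝ) 0).symm p)) :=
    hF1.comp m2.measurable
  rw [← m2.lintegral_comp hF1, Measure.volume_eq_prod, lintegral_prod _ hF3.aemeasurable]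
  refine lintegral_congr fun x₁ => ?_
  have hF2 : Measurable fun y : Fin 2 → ℝ => F (WithLp.toLp 2
      ((MeasurableEquiv.piFinSuccAbove (fun _ : Fin 3 => ℝ) 0).symm (x₁, y))) :=
    hF1.comp (m2.measurable.comp measurable_prodMk_left)
  refine (m3.lintegral_comp hF2).symm.trans (lintegral_congr fun p => ?_)
  congr 2
  ext i
  fin_cases i <;> rfl

/-- Integration over `Space 3` in spherical coordinates. -/
theorem lintegral_spherical (F : Space 3 → ℝ≥0∞) (hF : Measurable F) :
    ∫⁻ x, F x = ∫⁻ ρ in Ioi (0 : ℝ), ∫⁻ θ in Ioo 0 π, ∫⁻ φ in Ioo (-π) π,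
      ENNReal.ofReal (ρ ^ 2 * sin θ) * F (ρ • sphericalPoint θ φ) := by
  -- Polar coordinates are used twice: in the plane of the last two variables, giving `(r, φ)`, then
  -- in the plane of `(x₁, r)`, giving `(ρ, θ)`. The constraint `r > 0` cuts the second angle down
  -- to `(0, π)`.
  set H : ℝ → ℝ → ℝ≥0∞ := fun x r => ∫⁻ φ in Ioo (-π) π, F !₂[x, r * cos φ, r * sin φ] with hH
  have hHm : Measurable (Function.uncurry H) := by
    refine Measurable.lintegral_prod_right (f := fun (p : ℝ × ℝ) φ =>
      F !₂[p.1, p.2 * cos φ, p.2 * sin φ]) (hF.comp (Continuous.measurable ?_))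
    fun_prop
  have h1 : ∀ x₁ : ℝ, ∫⁻ p : ℝ × ℝ, F !₂[x₁, p.1, p.2]
      = ∫⁻ r : ℝ, (Ioi (0 : ℝ)).indicator (fun r => ENNReal.ofReal r * H x₁ r) r := by
    intro x₁
    rw [lintegral_indicator measurableSet_Ioi, ← lintegral_comp_polarCoord_symm, polarCoord_target,
      Measure.volume_eq_prod, ← Measure.prod_restrict, lintegral_prod]
    · refine lintegral_congr fun r => ?_
      simp only [polarCoord_symm_apply, smul_eq_mul, hH]
      rw [lintegral_const_mul]
      exact hF.comp (Continuous.measurable (by fun_prop))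
    · refine Measurable.aemeasurable (Measurable.mul (by fun_prop) (hF.comp ?_))
      refine Continuous.measurable ?_
      simp only [polarCoord_symm_apply]
      fun_prop
  have h2 : Measurable fun p : ℝ × ℝ =>
      (Ioi (0 : ℝ)).indicator (fun r => ENNReal.ofReal r * H p.1 r) p.2 := by
    have : (fun p : ℝ × ℝ => (Ioi (0 : ℝ)).indicator (fun r => ENNReal.ofReal r * H p.1 r) p.2)
        = (Prod.snd ⁻¹' Ioi (0 : ℝ)).indicator
          (fun p : ℝ × ℝ => ENNReal.ofReal p.2 * H p.1 p.2) := by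
      ext p; simp [indicator]
    rw [this]
    exact ((by fun_prop : Measurable fun p : ℝ × ℝ => ENNReal.ofReal p.2).mul hHm).indicator
      (measurable_snd measurableSet_Ioi)
  have hpol : Measurable fun p : ℝ × ℝ => polarCoord.symm p :=
    Continuous.measurable (by simp only [polarCoord_symm_apply]; fun_prop)
  rw [lintegral_space3 F hF]
  simp only [h1]
  rw [← lintegral_prod _ h2.aemeasurable, ← Measure.volume_eq_prod,
    ← lintegral_comp_polarCoord_symm, polarCoord_target, Measure.volume_eq_prod,
    ← Measure.prod_restrict, lintegral_prod]
  swap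
  · refine Measurable.aemeasurable (Measurable.mul (by fun_prop) (h2.comp hpol))
  refine setLIntegral_congr_fun measurableSet_Ioi fun ρ hρ => ?_
  have hρ : 0 < ρ := hρ
  beta_reduce
  simp only [polarCoord_symm_apply, smul_eq_mul]
  have hsub : Ioo 0 π ⊆ Ioo (-π) π := Ioo_subset_Ioo_left (by linarith [pi_pos])
  rw [← lintegral_inter_add_sdiff _ _ (measurableSet_Ioo : MeasurableSet (Ioo 0 π)),
    inter_eq_self_of_subset_right hsub,
    setLIntegral_eq_zero (s := Ioo (-π) π \ Ioo 0 π)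
      (measurableSet_Ioo.diff measurableSet_Ioo), add_zero]
  · refine setLIntegral_congr_fun measurableSet_Ioo fun θ hθ => ?_
    have hs : 0 < ρ * sin θ := mul_pos hρ (sin_pos_of_mem_Ioo hθ)
    rw [indicator_of_mem (by exact hs), hH, ← mul_assoc, ← ENNReal.ofReal_mul hρ.le,
      lintegral_const_mul]
    · rw [show ρ * (ρ * sin θ) = ρ ^ 2 * sin θ by ring]
      · refine congrArg _ (lintegral_congr fun φ => ?_)
        congr 1
        ext i
        fin_cases i <;> simp [sphericalPoint, mul_assoc]
    · exact hF.comp (Continuous.measurable (by fun_prop))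
  · intro θ hθ
    have hs : ρ * sin θ ≤ 0 := by
      refine mul_nonpos_of_nonneg_of_nonpos hρ.le
        (sin_nonpos_of_nonpos_of_neg_pi_le ?_ hθ.1.1.le)
      by_contra h
      exact hθ.2 ⟨not_le.1 h, hθ.1.2⟩
    simp [indicator, not_lt.2 hs]

theorem norm_sphericalPoint (θ φ : ℝ) : ‖sphericalPoint θ φ‖ = 1 := by
  rw [EuclideanSpace.norm_eq, sqrt_eq_one]
  simp [sphericalPoint, Fin.sum_univ_three]
  linear_combination (sin θ ^ 2) * sin_sq_add_cos_sq φ + sin_sq_add_cos_sq θ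

theorem setLIntegral_Ioo_ofReal {g : ℝ → ℝ} (hg : Continuous g) {a b : ℝ} (hab : a ≤ b)
    (h0 : ∀ x ∈ Ioo a b, 0 ≤ g x) :
    ∫⁻ x in Ioo a b, ENNReal.ofReal (g x) = ENNReal.ofReal (∫ x in a..b, g x) := by
  rw [integral_of_le hab, integral_Ioc_eq_integral_Ioo, ofReal_integral_eq_lintegral_ofReal]
  · exact hg.integrableOn_Icc.mono_set Ioo_subset_Icc_self
  · exact (ae_restrict_iff' measurableSet_Ioo).2 (Eventually.of_forall h0)

/-- Integration against a power weight in spherical coordinates. -/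
theorem lintegral_mul_norm_rpow (q : Space 3 → ℝ) (hq : Continuous q) (hq0 : ∀ x, 0 ≤ q x)
    (s : ℝ) :
    ∫⁻ x, ENNReal.ofReal (q x * ‖x‖ ^ s) = ∫⁻ ρ in Ioi (0 : ℝ), ENNReal.ofReal
      (ρ ^ (s + 2) * ∫ θ in (0)..π, ∫ φ in (-π)..π, sin θ * q (ρ • sphericalPoint θ φ)) := by
  rw [lintegral_spherical _ (by fun_prop)]
  refine setLIntegral_congr_fun measurableSet_Ioi fun ρ hρ => ?_
  have hρ : 0 < ρ := hρ
  have hπ : -π ≤ π := by linarith [pi_pos]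
  have hρs : 0 ≤ ρ ^ (s + 2) := rpow_nonneg hρ.le _
  have hin : ∀ θ ∈ Ioo 0 π, ∫⁻ φ in Ioo (-π) π, ENNReal.ofReal (ρ ^ 2 * sin θ) *
      ENNReal.ofReal (q (ρ • sphericalPoint θ φ) * ‖ρ • sphericalPoint θ φ‖ ^ s)
      = ENNReal.ofReal (ρ ^ (s + 2) *
          ∫ φ in (-π)..π, sin θ * q (ρ • sphericalPoint θ φ)) := by
    intro θ hθ
    have hs : 0 ≤ sin θ := (sin_pos_of_mem_Ioo hθ).le
    rw [← intervalIntegral.integral_const_mul, ← setLIntegral_Ioo_ofReal (by fun_prop) hπ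
      fun φ _ => mul_nonneg hρs (mul_nonneg hs (hq0 _))]
    refine lintegral_congr fun φ => ?_
    rw [← ENNReal.ofReal_mul (by positivity), norm_smul, norm_sphericalPoint, mul_one,
      norm_of_nonneg hρ.le, rpow_add hρ, rpow_two]
    congr 1
    ring
  rw [setLIntegral_congr_fun measurableSet_Ioo hin, ← intervalIntegral.integral_const_mul,
    setLIntegral_Ioo_ofReal (by fun_prop) pi_pos.le]
  exact fun θ hθ => mul_nonneg hρs (integral_nonneg hπ fun φ _ =>
    mul_nonneg (sin_pos_of_mem_Ioo hθ).le (hq0 _))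

/-! ### The spherical frame and the derivatives of the components of `u`. -/

/-- The frame vector `e_θ`. -/
noncomputable def polarVector (θ φ : ℝ) : Space 3 :=
  !₂[-sin θ, cos θ * cos φ, cos θ * sin φ]

@[fun_prop]
theorem continuous_polarVector {X : Type*} [TopologicalSpace X] {θ φ : X → ℝ}
    (hθ : Continuous θ) (hφ : Continuous φ) : Continuous fun x => polarVector (θ x) (φ x) := by
  unfold polarVector
  fun_prop

@[fun_prop]
theorem continuous_azimuthalVector {X : Type*} [TopologicalSpace X] {φ : X → ℝ}
    (hφ : Continuous φ) : Continuous fun x => azimuthalVector (φ x) := by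
  unfold azimuthalVector
  fun_prop

theorem hasDerivAt_vec3 {a b c : ℝ → ℝ} {a' b' c' t : ℝ} (ha : HasDerivAt a a' t)
    (hb : HasDerivAt b b' t) (hc : HasDerivAt c c' t) :
    HasDerivAt (fun t => (!₂[a t, b t, c t] : Space 3)) !₂[a', b', c'] t := by
  have h : HasDerivAt (fun t => ![a t, b t, c t]) ![a', b', c'] t := by
    rw [hasDerivAt_pi]
    intro i
    fin_cases i <;> assumption
  exact (PiLp.continuousLinearEquiv 2 ℝ fun _ : Fin 3 => ℝ).symm.hasFDerivAt.comp_hasDerivAt t h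

theorem hasDerivAt_sphericalPoint_polar (θ φ : ℝ) :
    HasDerivAt (fun θ => sphericalPoint θ φ) (polarVector θ φ) θ :=
  hasDerivAt_vec3 (hasDerivAt_cos θ) ((hasDerivAt_sin θ).mul_const _)
    ((hasDerivAt_sin θ).mul_const _)

theorem hasDerivAt_polarVector_polar (θ φ : ℝ) :
    HasDerivAt (fun θ => polarVector θ φ) (-sphericalPoint θ φ) θ := by
  refine (hasDerivAt_vec3 (hasDerivAt_sin θ).neg ((hasDerivAt_cos θ).mul_const _)
    ((hasDerivAt_cos θ).mul_const _)).congr_deriv ?_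
  ext i
  fin_cases i <;> simp [sphericalPoint]

theorem hasDerivAt_sphericalPoint_azimuth (θ φ : ℝ) :
    HasDerivAt (fun φ => sphericalPoint θ φ) (sin θ • azimuthalVector φ) φ := by
  refine (hasDerivAt_vec3 (hasDerivAt_const φ _) ((hasDerivAt_cos φ).const_mul _)
    ((hasDerivAt_sin φ).const_mul _)).congr_deriv ?_
  ext i
  fin_cases i <;> simp [azimuthalVector]

theorem hasDerivAt_polarVector_azimuth (θ φ : ℝ) :
    HasDerivAt (fun φ => polarVector θ φ) (cos θ • azimuthalVector φ) φ := by
  refine (hasDerivAt_vec3 (hasDerivAt_const φ _) ((hasDerivAt_cos φ).const_mul _)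
    ((hasDerivAt_sin φ).const_mul _)).congr_deriv ?_
  ext i
  fin_cases i <;> simp [azimuthalVector]

theorem hasDerivAt_azimuthalVector (θ φ : ℝ) :
    HasDerivAt azimuthalVector (-(sin θ • sphericalPoint θ φ + cos θ • polarVector θ φ)) φ := by
  refine (hasDerivAt_vec3 (hasDerivAt_const φ _) (hasDerivAt_sin φ).neg
    (hasDerivAt_cos φ)).congr_deriv ?_
  have := sin_sq_add_cos_sq θ
  ext i
  fin_cases i <;> simp [sphericalPoint, polarVector]
  · ring
  · linear_combination cos φ * this
  · linear_combination sin φ * this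

theorem norm_sq_eq_frame (m : Space 3) (θ φ : ℝ) :
    ‖m‖ ^ 2 = inner ℝ m (sphericalPoint θ φ) ^ 2 + inner ℝ m (polarVector θ φ) ^ 2
      + inner ℝ m (azimuthalVector φ) ^ 2 := by
  simp only [EuclideanSpace.norm_sq_eq, PiLp.inner_apply, Fin.sum_univ_three, sphericalPoint,
    polarVector, azimuthalVector, norm_eq_abs, sq_abs]
  simp
  have h1 := sin_sq_add_cos_sq θ
  have h2 := sin_sq_add_cos_sq φ
  linear_combination (-(m 0 ^ 2) - (m 1 * cos φ + m 2 * sin φ) ^ 2) * h1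
    + (-(m 1 ^ 2) - m 2 ^ 2) * h2

/-- The entry `(∇_v u) · w` of the gradient. -/
noncomputable def gradEntry (u : Space 3 → Space 3) (x v w : Space 3) : ℝ :=
  inner ℝ (fderiv ℝ u x v) w

theorem fderiv_eq_sum_partialDeriv (u : Space 3 → Space 3) (x v : Space 3) :
    fderiv ℝ u x v = ∑ i, v i • partialDeriv i u x := by
  have hv : v = ∑ i, v i • (EuclideanSpace.single i (1 : ℝ) : Space 3) := by
    ext j
    simp [Finset.sum_apply, Pi.single_apply]
  conv_lhs => rw [hv]
  simp [partialDeriv]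

theorem divergence_eq_frame (u : Space 3 → Space 3) (x : Space 3) (θ φ : ℝ) :
    divergence u x = gradEntry u x (sphericalPoint θ φ) (sphericalPoint θ φ)
      + gradEntry u x (polarVector θ φ) (polarVector θ φ)
      + gradEntry u x (azimuthalVector φ) (azimuthalVector φ) := by
  simp only [divergence, gradEntry, fderiv_eq_sum_partialDeriv u x, PiLp.inner_apply,
    Fin.sum_univ_three, sphericalPoint, polarVector, azimuthalVector]
  simp
  have h1 := sin_sq_add_cos_sq θ
  have h2 := sin_sq_add_cos_sq φ
  set p := fun i j => partialDeriv i u x j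
  change p 0 0 + p 1 1 + p 2 2 = _
  linear_combination (-(p 0 0) - p 1 1 * cos φ ^ 2 - p 2 2 * sin φ ^ 2
    - (p 1 2 + p 2 1) * sin φ * cos φ) * h1 - (p 1 1 + p 2 2) * h2

theorem gradNormSq_eq_frame (u : Space 3 → Space 3) (x : Space 3) (θ φ : ℝ) :
    gradNormSq u x = ‖fderiv ℝ u x (sphericalPoint θ φ)‖ ^ 2
      + ‖fderiv ℝ u x (polarVector θ φ)‖ ^ 2 + ‖fderiv ℝ u x (azimuthalVector φ)‖ ^ 2 := by
  have key : ∀ j : Fin 3, ∑ i, partialDeriv i u x j ^ 2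
      = (fderiv ℝ u x (sphericalPoint θ φ)) j ^ 2 + (fderiv ℝ u x (polarVector θ φ)) j ^ 2
        + (fderiv ℝ u x (azimuthalVector φ)) j ^ 2 := by
    intro j
    have h := norm_sq_eq_frame !₂[partialDeriv 0 u x j, partialDeriv 1 u x j,
      partialDeriv 2 u x j] θ φ
    simp only [EuclideanSpace.norm_sq_eq, PiLp.inner_apply, Fin.sum_univ_three] at h
    simp only [fderiv_eq_sum_partialDeriv u x, Fin.sum_univ_three]
    simpa [mul_comm] using h
  rw [gradNormSq, Finset.sum_comm]
  simp only [key, EuclideanSpace.norm_sq_eq, norm_eq_abs, sq_abs, Finset.sum_add_distrib]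

/-- The radial component of a vector field. -/
noncomputable def radialComponent (u : Space 3 → Space 3) (ρ θ φ : ℝ) : ℝ :=
  inner ℝ (u (ρ • sphericalPoint θ φ)) (sphericalPoint θ φ)

/-- The component of a vector field along `e_θ`. -/
noncomputable def polarComponent (u : Space 3 → Space 3) (ρ θ φ : ℝ) : ℝ :=
  inner ℝ (u (ρ • sphericalPoint θ φ)) (polarVector θ φ)

theorem norm_sq_eq_components (u : Space 3 → Space 3) (ρ θ φ : ℝ) :
    ‖u (ρ • sphericalPoint θ φ)‖ ^ 2
      = radialComponent u ρ θ φ ^ 2 + polarComponent u ρ θ φ ^ 2 + swirlComponent u ρ θ φ ^ 2 :=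
  norm_sq_eq_frame _ _ _

section Derivatives

variable {u : Space 3 → Space 3}

theorem hasDerivAt_inner_comp (hu : Differentiable ℝ u) {x e : ℝ → Space 3} {x' e' : Space 3} {t : ℝ}
    (hx : HasDerivAt x x' t) (he : HasDerivAt e e' t) :
    HasDerivAt (fun t => inner ℝ (u (x t)) (e t))
      (inner ℝ (u (x t)) e' + gradEntry u (x t) x' (e t)) t :=
  ((hu (x t)).hasFDerivAt.comp_hasDerivAt t hx).inner ℝ he

theorem hasDerivAt_radialComponent_radial (hu : Differentiable ℝ u) (ρ θ φ : ℝ) :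
    HasDerivAt (fun ρ => radialComponent u ρ θ φ)
      (gradEntry u (ρ • sphericalPoint θ φ) (sphericalPoint θ φ) (sphericalPoint θ φ)) ρ := by
  refine (hasDerivAt_inner_comp hu ((hasDerivAt_id ρ).smul_const (sphericalPoint θ φ))
    (hasDerivAt_const ρ (sphericalPoint θ φ))).congr_deriv ?_
  simp

theorem hasDerivAt_polarComponent_radial (hu : Differentiable ℝ u) (ρ θ φ : ℝ) :
    HasDerivAt (fun ρ => polarComponent u ρ θ φ)
      (gradEntry u (ρ • sphericalPoint θ φ) (sphericalPoint θ φ) (polarVector θ φ)) ρ := by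
  refine (hasDerivAt_inner_comp hu ((hasDerivAt_id ρ).smul_const (sphericalPoint θ φ))
    (hasDerivAt_const ρ (polarVector θ φ))).congr_deriv ?_
  simp

theorem hasDerivAt_swirlComponent_radial (hu : Differentiable ℝ u) (ρ θ φ : ℝ) :
    HasDerivAt (fun ρ => swirlComponent u ρ θ φ)
      (gradEntry u (ρ • sphericalPoint θ φ) (sphericalPoint θ φ) (azimuthalVector φ)) ρ := by
  refine (hasDerivAt_inner_comp hu ((hasDerivAt_id ρ).smul_const (sphericalPoint θ φ))
    (hasDerivAt_const ρ (azimuthalVector φ))).congr_deriv ?_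
  simp

theorem hasDerivAt_radialComponent_polar (hu : Differentiable ℝ u) (ρ θ φ : ℝ) :
    HasDerivAt (fun θ => radialComponent u ρ θ φ)
      (ρ * gradEntry u (ρ • sphericalPoint θ φ) (polarVector θ φ) (sphericalPoint θ φ)
        + polarComponent u ρ θ φ) θ := by
  refine (hasDerivAt_inner_comp hu ((hasDerivAt_sphericalPoint_polar θ φ).const_smul ρ)
    (hasDerivAt_sphericalPoint_polar θ φ)).congr_deriv ?_
  simp [gradEntry, polarComponent, inner_smul_left, add_comm]

theorem hasDerivAt_polarComponent_polar (hu : Differentiable ℝ u) (ρ θ φ : ℝ) :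
    HasDerivAt (fun θ => polarComponent u ρ θ φ)
      (ρ * gradEntry u (ρ • sphericalPoint θ φ) (polarVector θ φ) (polarVector θ φ)
        - radialComponent u ρ θ φ) θ := by
  refine (hasDerivAt_inner_comp hu ((hasDerivAt_sphericalPoint_polar θ φ).const_smul ρ)
    (hasDerivAt_polarVector_polar θ φ)).congr_deriv ?_
  simp [gradEntry, radialComponent, inner_smul_left]
  ring

theorem hasDerivAt_swirlComponent_polar (hu : Differentiable ℝ u) (ρ θ φ : ℝ) :
    HasDerivAt (fun θ => swirlComponent u ρ θ φ)
      (ρ * gradEntry u (ρ • sphericalPoint θ φ) (polarVector θ φ) (azimuthalVector φ)) θ := by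
  refine (hasDerivAt_inner_comp hu ((hasDerivAt_sphericalPoint_polar θ φ).const_smul ρ)
    (hasDerivAt_const θ (azimuthalVector φ))).congr_deriv ?_
  simp [gradEntry, inner_smul_left]

theorem hasDerivAt_radialComponent_azimuth (hu : Differentiable ℝ u) (ρ θ φ : ℝ) :
    HasDerivAt (fun φ => radialComponent u ρ θ φ)
      (ρ * sin θ * gradEntry u (ρ • sphericalPoint θ φ) (azimuthalVector φ) (sphericalPoint θ φ)
        + sin θ * swirlComponent u ρ θ φ) φ := by
  refine (hasDerivAt_inner_comp hu ((hasDerivAt_sphericalPoint_azimuth θ φ).const_smul ρ)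
    (hasDerivAt_sphericalPoint_azimuth θ φ)).congr_deriv ?_
  simp [gradEntry, swirlComponent, inner_smul_left, inner_smul_right]
  ring

theorem hasDerivAt_polarComponent_azimuth (hu : Differentiable ℝ u) (ρ θ φ : ℝ) :
    HasDerivAt (fun φ => polarComponent u ρ θ φ)
      (ρ * sin θ * gradEntry u (ρ • sphericalPoint θ φ) (azimuthalVector φ) (polarVector θ φ)
        + cos θ * swirlComponent u ρ θ φ) φ := by
  refine (hasDerivAt_inner_comp hu ((hasDerivAt_sphericalPoint_azimuth θ φ).const_smul ρ)
    (hasDerivAt_polarVector_azimuth θ φ)).congr_deriv ?_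
  simp [gradEntry, swirlComponent, inner_smul_left, inner_smul_right]
  ring

theorem hasDerivAt_swirlComponent_azimuth (hu : Differentiable ℝ u) (ρ θ φ : ℝ) :
    HasDerivAt (fun φ => swirlComponent u ρ θ φ)
      (ρ * sin θ * gradEntry u (ρ • sphericalPoint θ φ) (azimuthalVector φ) (azimuthalVector φ)
        - (sin θ * radialComponent u ρ θ φ + cos θ * polarComponent u ρ θ φ)) φ := by
  refine (hasDerivAt_inner_comp hu ((hasDerivAt_sphericalPoint_azimuth θ φ).const_smul ρ)
    (hasDerivAt_azimuthalVector θ φ)).congr_deriv ?_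
  simp [gradEntry, radialComponent, polarComponent, inner_smul_left, inner_smul_right,
    inner_add_right]
  ring

end Derivatives

/-! ### Consequences of an axisymmetric swirl component. -/

section Swirl

variable {u : Space 3 → Space 3}

theorem swirlComponent_add_two_pi (ρ θ φ : ℝ) :
    swirlComponent u ρ θ (φ + 2 * π) = swirlComponent u ρ θ φ := by
  simp [swirlComponent, sphericalPoint, azimuthalVector]

/-- An axisymmetric swirl component is independent of the azimuth also on the polar axis. -/
theorem HasAxisymmetricSwirl.eq_zero_azimuth (hs : HasAxisymmetricSwirl u) (hu : Continuous u)
    {ρ θ : ℝ} (hρ : 0 ≤ ρ) (hθ : θ ∈ Icc 0 π) (φ : ℝ) :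
    swirlComponent u ρ θ φ = swirlComponent u ρ θ 0 := by
  have hcl : IsClosed {p : ℝ × ℝ | swirlComponent u p.1 p.2 φ = swirlComponent u p.1 p.2 0} := by
    refine isClosed_eq ?_ ?_ <;> unfold swirlComponent <;> fun_prop
  have hsub : Ioi (0 : ℝ) ×ˢ Ioo 0 π ⊆
      {p : ℝ × ℝ | swirlComponent u p.1 p.2 φ = swirlComponent u p.1 p.2 0} := by
    rintro ⟨r, t⟩ ⟨hr, ht⟩
    have hper : Function.Periodic (fun φ => swirlComponent u r t φ) (2 * π) :=
      fun φ => swirlComponent_add_two_pi r t φ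
    obtain ⟨ψ, hψ, hψe⟩ := hper.exists_mem_Ico₀ two_pi_pos φ
    change swirlComponent u r t φ = swirlComponent u r t 0
    rw [hψe]
    exact hs r t ψ 0 hr ht hψ ⟨le_rfl, two_pi_pos⟩
  have hmem : (ρ, θ) ∈ closure (Ioi (0 : ℝ) ×ˢ Ioo 0 π) := by
    rw [closure_prod_eq, closure_Ioi, closure_Ioo pi_pos.ne]
    exact ⟨hρ, hθ⟩
  exact hcl.closure_subset_iff.2 hsub hmem

/-- On the axis the point does not move with `φ` while `e_φ` turns through all directions of the
transverse plane; a fixed vector with constant coefficient along `e_φ` has no transverse part. -/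
theorem HasAxisymmetricSwirl.eq_zero_of_sin_eq_zero (hs : HasAxisymmetricSwirl u)
    (hu : Continuous u) {ρ θ : ℝ} (hρ : 0 ≤ ρ) (hθ : θ ∈ Icc 0 π) (hsin : sin θ = 0) (φ : ℝ) :
    swirlComponent u ρ θ φ = 0 ∧ polarComponent u ρ θ φ = 0 := by
  have h := hs.eq_zero_azimuth hu hρ hθ
  have h1 := h π
  have h2 := h (π / 2)
  have h3 := h (-(π / 2))
  have h4 := h φ
  simp only [swirlComponent, polarComponent, sphericalPoint, hsin, azimuthalVector, polarVector,
    PiLp.inner_apply, Fin.sum_univ_three] at h1 h2 h3 h4 ⊢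
  simp at h1 h2 h3 h4 ⊢
  have e2 : (u (ρ • !₂[cos θ, 0, 0])) 2 = 0 := by linarith
  have e1 : (u (ρ • !₂[cos θ, 0, 0])) 1 = 0 := by linarith
  simp [e1, e2]

end Swirl

/-! ### Exchange of integrals and continuity of the integrands. -/

theorem intervalIntegral_swap {F : ℝ → ℝ → ℝ} (hF : Continuous (Function.uncurry F))
    {a b c d : ℝ} (hab : a ≤ b) (hcd : c ≤ d) :
    ∫ x in a..b, ∫ y in c..d, F x y = ∫ y in c..d, ∫ x in a..b, F x y := by
  simp only [integral_of_le hab, integral_of_le hcd]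
  refine integral_integral_swap ?_
  rw [Measure.prod_restrict]
  exact (hF.continuousOn.integrableOn_compact (isCompact_Icc.prod isCompact_Icc)).mono_set
    (prod_mono Ioc_subset_Icc_self Ioc_subset_Icc_self)

section Continuity

variable {u : Space 3 → Space 3} {X : Type*} [TopologicalSpace X]

@[fun_prop]
theorem continuous_gradEntry (hu : ContDiff ℝ 1 u) {x v w : X → Space 3}
    (hx : Continuous x) (hv : Continuous v) (hw : Continuous w) :
    Continuous fun p => gradEntry u (x p) (v p) (w p) := by
  have := hu.continuous_fderiv one_ne_zero
  unfold gradEntry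
  fun_prop

@[fun_prop]
theorem continuous_radialComponent (hu : Continuous u) {ρ θ φ : X → ℝ}
    (hρ : Continuous ρ) (hθ : Continuous θ) (hφ : Continuous φ) :
    Continuous fun p => radialComponent u (ρ p) (θ p) (φ p) := by
  unfold radialComponent
  fun_prop

@[fun_prop]
theorem continuous_polarComponent (hu : Continuous u) {ρ θ φ : X → ℝ}
    (hρ : Continuous ρ) (hθ : Continuous θ) (hφ : Continuous φ) :
    Continuous fun p => polarComponent u (ρ p) (θ p) (φ p) := by
  unfold polarComponent
  fun_prop

@[fun_prop]
theorem continuous_swirlComponent (hu : Continuous u) {ρ θ φ : X → ℝ}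
    (hρ : Continuous ρ) (hθ : Continuous θ) (hφ : Continuous φ) :
    Continuous fun p => swirlComponent u (ρ p) (θ p) (φ p) := by
  unfold swirlComponent
  fun_prop

@[fun_prop]
theorem continuous_gradNormSq (hu : ContDiff ℝ 1 u) {x : X → Space 3} (hx : Continuous x) :
    Continuous fun p => gradNormSq u (x p) := by
  have := hu.continuous_fderiv one_ne_zero
  unfold gradNormSq partialDeriv
  fun_prop

end Continuity

/-! ### Lower bound for the Dirichlet integral on a sphere. -/

section Sphere

variable {u : Space 3 → Space 3}

/-- This is `∂_φ u_φ = 0` in terms of the gradient; it eliminates the azimuthal derivative from the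
divergence. -/
theorem HasAxisymmetricSwirl.gradEntry_azimuth (hs : HasAxisymmetricSwirl u)
    (hu : ContDiff ℝ 1 u) {ρ θ : ℝ} (hρ : 0 ≤ ρ) (hθ : θ ∈ Icc 0 π) (φ : ℝ) :
    ρ * sin θ * gradEntry u (ρ • sphericalPoint θ φ) (azimuthalVector φ) (azimuthalVector φ)
      = sin θ * radialComponent u ρ θ φ + cos θ * polarComponent u ρ θ φ := by
  have h1 := hasDerivAt_swirlComponent_azimuth (hu.differentiable one_ne_zero) ρ θ φ
  have h2 : (fun φ => swirlComponent u ρ θ φ) = fun _ => swirlComponent u ρ θ 0 :=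
    funext fun φ => hs.eq_zero_azimuth hu.continuous hρ hθ φ
  rw [h2] at h1
  linarith [h1.unique (hasDerivAt_const φ _)]

/-- For a solenoidal field with axisymmetric swirl, the radial component has mean zero along every
meridian. -/
theorem integral_radialComponent_mul_sin (hu : ContDiff ℝ 1 u) (hdiv : IsSolenoidal u)
    (hs : HasAxisymmetricSwirl u) {ρ : ℝ} (hρ : 0 < ρ) (φ : ℝ) :
    ∫ θ in (0)..π, radialComponent u ρ θ φ * sin θ = 0 := by
  have hd := hu.differentiable one_ne_zero
  have huc := hu.continuous
  -- `N'` is the `s`-derivative of `s² u_ρ sin θ` and, by the divergence equation, the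
  -- `θ`-derivative of `-s u_θ sin θ`. Integrating it over `[0, π] × [0, ρ]` in both orders gives
  -- `ρ²` times the meridian mean on one side and 0 on the other.
  set N' : ℝ → ℝ → ℝ := fun θ s => sin θ * (2 * s * radialComponent u s θ φ + s ^ 2 *
    gradEntry u (s • sphericalPoint θ φ) (sphericalPoint θ φ) (sphericalPoint θ φ)) with hN'
  have hNc : Continuous (Function.uncurry N') := by
    simp only [hN', Function.uncurry_def]
    fun_prop
  have h1 : ∀ θ, ∫ s in (0)..ρ, N' θ s = ρ ^ 2 * (radialComponent u ρ θ φ * sin θ) := by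
    intro θ
    have hder : ∀ s, HasDerivAt (fun s => sin θ * (s ^ 2 * radialComponent u s θ φ)) (N' θ s) s :=
      fun s => by
        refine (((hasDerivAt_pow 2 s).mul
          (hasDerivAt_radialComponent_radial hd s θ φ)).const_mul (sin θ)).congr_deriv ?_
        simp [hN']
    rw [intervalIntegral.integral_eq_sub_of_hasDerivAt (fun s _ => hder s)
      (Continuous.intervalIntegrable (by fun_prop) _ _)]
    ring
  have h2 : ∀ s ∈ Icc 0 ρ, ∫ θ in (0)..π, N' θ s = 0 := by
    intro s hs0
    have hder : ∀ θ : ℝ, HasDerivAt (fun θ : ℝ => -(s * (sin θ * polarComponent u s θ φ)))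
        (-(s * (cos θ * polarComponent u s θ φ + sin θ * (s * gradEntry u (s • sphericalPoint θ φ)
          (polarVector θ φ) (polarVector θ φ) - radialComponent u s θ φ)))) θ :=
      fun θ => (((hasDerivAt_sin θ).mul (hasDerivAt_polarComponent_polar hd s θ φ)).const_mul
        s).neg
    have hint := integral_eq_sub_of_hasDerivAt (a := 0) (b := π) (fun θ _ => hder θ)
      (Continuous.intervalIntegrable (by fun_prop) _ _)
    simp only [sin_pi, sin_zero, zero_mul, mul_zero, neg_zero, sub_zero] at hint
    refine Eq.trans ?_ hint
    refine intervalIntegral.integral_congr fun θ hθ => ?_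
    rw [uIcc_of_le pi_pos.le] at hθ
    have e1 := hs.gradEntry_azimuth hu hs0.1 hθ φ
    have e2 := divergence_eq_frame u (s • sphericalPoint θ φ) θ φ
    rw [hdiv] at e2
    simp only [hN']
    linear_combination (-s) * e1 - s ^ 2 * sin θ * e2
  have h3 := intervalIntegral_swap hNc pi_pos.le hρ.le
  simp only [h1] at h3
  rw [intervalIntegral.integral_const_mul, intervalIntegral.integral_congr (g := fun _ => (0 : ℝ))
    (fun s hs0 => h2 s (by rwa [uIcc_of_le hρ.le] at hs0))] at h3
  simpa [hρ.ne'] using h3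

/-- Here `s = sin θ`, `c = cos θ`, `f, w, h` are the components of `u`, and `r`, `p`, `a` are `ρ`
times the gradient entries in the directions `σ`, `e_θ`, `e_φ`. Thus `p₁ + w = ∂_θ f`, `p₂ - f = ∂_θ
w`, `p₃ = ∂_θ h`, and `a₃ - f = cot θ w`. The second summand on the left is a `θ`-derivative and the
second on the right is `2h / sin θ` times a `φ`-derivative. -/
theorem sphere_energy_algebra {s c κ f w h r₁ r₂ r₃ p₁ p₂ p₃ a₁ a₂ a₃ : ℝ} (hs : 0 < s)
    (hκ : 0 ≤ κ) (ha : s * a₃ = s * f + c * w) (hdiv : r₁ + p₂ + a₃ = 0) :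
    s * (r₁ ^ 2 + r₂ ^ 2 + r₃ ^ 2 + (p₁ + w) ^ 2 + 2 * f ^ 2 - 4 * f * (r₁ + 2 * f)
        + (1 - κ) * (r₁ + 2 * f) ^ 2 + 2 * κ * w ^ 2 + 2 * h ^ 2)
      + ((2 * κ - 1) * (-s * w ^ 2 + 2 * c * w * (p₂ - f)) + (-s * h ^ 2 + 2 * c * h * p₃)
        - 2 * (c * f * w + s * (p₁ + w) * w + s * f * (p₂ - f)))
    ≤ s * (r₁ ^ 2 + r₂ ^ 2 + r₃ ^ 2 + (p₁ ^ 2 + p₂ ^ 2 + p₃ ^ 2) + (a₁ ^ 2 + a₂ ^ 2 + a₃ ^ 2))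
      + 1 / s * (2 * h * (s * (s * a₁ + s * h) + c * (s * a₂ + c * h))) := by
  obtain rfl : r₁ = -p₂ - a₃ := by linarith
  obtain ⟨t, rfl⟩ : ∃ t, c = s * t := ⟨c / s, by field_simp⟩
  -- The difference of the two sides is exactly this sum, with `t = cot θ`. In order, the squares
  -- are those of `∂_φ f / sin θ`, `∂_φ w / sin θ`, `∂_θ h - cot θ h` and `∂_θ w - cot θ w`.
  have h0 : 0 ≤ s * (a₁ + h) ^ 2 + s * (a₂ + t * h) ^ 2 + s * (p₃ - t * h) ^ 2
      + κ * s * (2 * (p₂ - f) - (p₂ + a₃ - 2 * f)) ^ 2 := by positivity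
  refine sub_nonneg.1 (h0.trans_eq ?_)
  have e : 1 / s * (2 * h * (s * (s * a₁ + s * h) + s * t * (s * a₂ + s * t * h)))
      = 2 * h * ((s * a₁ + s * h) + t * (s * a₂ + s * t * h)) := by
    field_simp
  rw [e]
  linear_combination (2 * p₂ - 4 * κ * (p₂ - f)) * ha

/-- The integrand bounding the Dirichlet integrand on a sphere from below, after the angular
derivatives have been integrated out. -/
noncomputable def sphereForm (u : Space 3 → Space 3) (κ ρ θ φ : ℝ) : ℝ :=
  ρ ^ 2 * (gradEntry u (ρ • sphericalPoint θ φ) (sphericalPoint θ φ) (sphericalPoint θ φ) ^ 2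
    + gradEntry u (ρ • sphericalPoint θ φ) (sphericalPoint θ φ) (polarVector θ φ) ^ 2
    + gradEntry u (ρ • sphericalPoint θ φ) (sphericalPoint θ φ) (azimuthalVector φ) ^ 2)
  + 4 * radialComponent u ρ θ φ ^ 2
  - 4 * radialComponent u ρ θ φ * (ρ * gradEntry u (ρ • sphericalPoint θ φ) (sphericalPoint θ φ)
      (sphericalPoint θ φ) + 2 * radialComponent u ρ θ φ)
  + (1 - κ) * (ρ * gradEntry u (ρ • sphericalPoint θ φ) (sphericalPoint θ φ)
      (sphericalPoint θ φ) + 2 * radialComponent u ρ θ φ) ^ 2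
  + 2 * κ * (polarComponent u ρ θ φ ^ 2 + swirlComponent u ρ θ φ ^ 2)

@[fun_prop]
theorem continuous_sphereForm {X : Type*} [TopologicalSpace X] (hu : ContDiff ℝ 1 u) (κ : ℝ)
    {ρ θ φ : X → ℝ} (hρ : Continuous ρ) (hθ : Continuous θ) (hφ : Continuous φ) :
    Continuous fun p => sphereForm u κ (ρ p) (θ p) (φ p) := by
  have := hu.continuous
  unfold sphereForm
  fun_prop

/-- The `θ`-derivative of `(2κ - 1) cos θ u_θ² + cos θ u_φ² - 2 sin θ u_ρ u_θ`. -/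
noncomputable def polarFluxDeriv (u : Space 3 → Space 3) (κ ρ θ φ : ℝ) : ℝ :=
  (2 * κ - 1) * (-sin θ * polarComponent u ρ θ φ ^ 2
        + 2 * cos θ * polarComponent u ρ θ φ
          * (ρ * gradEntry u (ρ • sphericalPoint θ φ) (polarVector θ φ) (polarVector θ φ)
            - radialComponent u ρ θ φ))
      + (-sin θ * swirlComponent u ρ θ φ ^ 2 + 2 * cos θ * swirlComponent u ρ θ φ
          * (ρ * gradEntry u (ρ • sphericalPoint θ φ) (polarVector θ φ) (azimuthalVector φ)))
      - 2 * (cos θ * radialComponent u ρ θ φ * polarComponent u ρ θ φ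
        + sin θ * (ρ * gradEntry u (ρ • sphericalPoint θ φ) (polarVector θ φ)
            (sphericalPoint θ φ) + polarComponent u ρ θ φ) * polarComponent u ρ θ φ
        + sin θ * radialComponent u ρ θ φ
          * (ρ * gradEntry u (ρ • sphericalPoint θ φ) (polarVector θ φ) (polarVector θ φ)
            - radialComponent u ρ θ φ))

@[fun_prop]
theorem continuous_polarFluxDeriv {X : Type*} [TopologicalSpace X] (hu : ContDiff ℝ 1 u) (κ : ℝ)
    {ρ θ φ : X → ℝ} (hρ : Continuous ρ) (hθ : Continuous θ) (hφ : Continuous φ) :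
    Continuous fun p => polarFluxDeriv u κ (ρ p) (θ p) (φ p) := by
  have := hu.continuous
  unfold polarFluxDeriv
  fun_prop

/-- The integrand `sphereForm`, with the angular terms that integrate to something nonnegative
along every meridian. -/
noncomputable def meridianForm (u : Space 3 → Space 3) (κ ρ θ φ : ℝ) : ℝ :=
  sin θ * sphereForm u κ ρ θ φ
  + ((ρ * gradEntry u (ρ • sphericalPoint θ φ) (polarVector θ φ) (sphericalPoint θ φ)
        + polarComponent u ρ θ φ) ^ 2 * sin θ - 2 * (radialComponent u ρ θ φ ^ 2 * sin θ))
  + polarFluxDeriv u κ ρ θ φ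

@[fun_prop]
theorem continuous_meridianForm {X : Type*} [TopologicalSpace X] (hu : ContDiff ℝ 1 u) (κ : ℝ)
    {ρ θ φ : X → ℝ} (hρ : Continuous ρ) (hθ : Continuous θ) (hφ : Continuous φ) :
    Continuous fun p => meridianForm u κ (ρ p) (θ p) (φ p) := by
  have := hu.continuous
  unfold meridianForm
  fun_prop

/-- The bracket in `meridianForm` has nonnegative integral by the spectral gap for `u_ρ`, and the
flux integrates to zero because `u_θ` and `u_φ` vanish at the poles. -/
theorem integral_sphereForm_le_meridian (hu : ContDiff ℝ 1 u) (hdiv : IsSolenoidal u)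
    (hs : HasAxisymmetricSwirl u) (κ : ℝ) {ρ : ℝ} (hρ : 0 < ρ) (φ : ℝ) :
    ∫ θ in (0)..π, sin θ * sphereForm u κ ρ θ φ ≤ ∫ θ in (0)..π, meridianForm u κ ρ θ φ := by
  have hd := hu.differentiable one_ne_zero
  have huc := hu.continuous
  have hpole : ∀ θ ∈ Icc 0 π, sin θ = 0 → swirlComponent u ρ θ φ = 0 ∧ polarComponent u ρ θ φ = 0 :=
    fun θ hθ h => hs.eq_zero_of_sin_eq_zero huc hρ.le hθ h φ
  have hgap := integral_sq_mul_sin_le (fun θ => hasDerivAt_radialComponent_polar hd ρ θ φ)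
    (by fun_prop) (integral_radialComponent_mul_sin hu hdiv hs hρ φ)
  have hbd := intervalIntegral.integral_eq_sub_of_hasDerivAt (a := 0) (b := π)
    (f := fun θ => (2 * κ - 1) * (cos θ * polarComponent u ρ θ φ ^ 2)
      + cos θ * swirlComponent u ρ θ φ ^ 2
      - 2 * (sin θ * radialComponent u ρ θ φ * polarComponent u ρ θ φ))
    (fun θ _ => ((((hasDerivAt_cos θ).mul
      ((hasDerivAt_polarComponent_polar hd ρ θ φ).pow 2)).const_mul (2 * κ - 1)).add
      ((hasDerivAt_cos θ).mul ((hasDerivAt_swirlComponent_polar hd ρ θ φ).pow 2))).sub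
      ((((hasDerivAt_sin θ).mul (hasDerivAt_radialComponent_polar hd ρ θ φ)).mul
        (hasDerivAt_polarComponent_polar hd ρ θ φ)).const_mul 2))
    (Continuous.intervalIntegrable (by simp only [Pi.mul_apply, Pi.pow_apply]; fun_prop) _ _)
  have p0 := hpole 0 ⟨le_rfl, pi_pos.le⟩ sin_zero
  have p1 := hpole π ⟨pi_pos.le, le_rfl⟩ sin_pi
  simp only [p0.1, p0.2, p1.1, p1.2, ne_eq, OfNat.ofNat_ne_zero, not_false_eq_true, zero_pow,
    mul_zero, add_zero, sub_zero] at hbd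
  unfold meridianForm
  rw [intervalIntegral.integral_add (Continuous.intervalIntegrable (by fun_prop) _ _)
      (Continuous.intervalIntegrable (by fun_prop) _ _),
    intervalIntegral.integral_add (Continuous.intervalIntegrable (by fun_prop) _ _)
      (Continuous.intervalIntegrable (by fun_prop) _ _),
    intervalIntegral.integral_sub (Continuous.intervalIntegrable (by fun_prop) _ _)
      (Continuous.intervalIntegrable (by fun_prop) _ _), intervalIntegral.integral_const_mul]
  have hflux : ∫ θ in (0)..π, polarFluxDeriv u κ ρ θ φ = 0 := by
    refine (intervalIntegral.integral_congr fun θ _ => ?_).trans hbd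
    simp only [polarFluxDeriv, Pi.mul_apply, Pi.pow_apply]
    push_cast
    ring
  linarith

/-- The last term is `2 u_φ / sin θ` times `∂_φ (sin θ u_ρ + cos θ u_θ)`; it vanishes after
integration in `φ` because `u_φ` is constant in `φ`. -/
theorem meridianForm_le (hu : ContDiff ℝ 1 u) (hdiv : IsSolenoidal u)
    (hs : HasAxisymmetricSwirl u) {κ : ℝ} (hκ0 : 0 ≤ κ) (hκ1 : κ ≤ 1) {ρ : ℝ} (hρ : 0 < ρ)
    {θ : ℝ} (hθ : θ ∈ Ioo 0 π) (φ : ℝ) :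
    meridianForm u κ ρ θ φ ≤ sin θ * (ρ ^ 2 * gradNormSq u (ρ • sphericalPoint θ φ))
      + 1 / sin θ * (2 * swirlComponent u ρ θ φ
        * (sin θ * (ρ * sin θ * gradEntry u (ρ • sphericalPoint θ φ) (azimuthalVector φ)
              (sphericalPoint θ φ) + sin θ * swirlComponent u ρ θ φ)
          + cos θ * (ρ * sin θ * gradEntry u (ρ • sphericalPoint θ φ) (azimuthalVector φ)
              (polarVector θ φ) + cos θ * swirlComponent u ρ θ φ))) := by
  have hsin := sin_pos_of_mem_Ioo hθ
  have e1 := hs.gradEntry_azimuth hu hρ.le (Ioo_subset_Icc_self hθ) φ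
  have e2 := divergence_eq_frame u (ρ • sphericalPoint θ φ) θ φ
  rw [hdiv] at e2
  have e3 := gradNormSq_eq_frame u (ρ • sphericalPoint θ φ) θ φ
  have hT : ∀ v w, inner ℝ (fderiv ℝ u (ρ • sphericalPoint θ φ) v) w
      = gradEntry u (ρ • sphericalPoint θ φ) v w := fun _ _ => rfl
  simp only [norm_sq_eq_frame _ θ φ, hT] at e3
  unfold meridianForm sphereForm polarFluxDeriv
  rw [e3]
  set T := gradEntry u (ρ • sphericalPoint θ φ)
  set f := radialComponent u ρ θ φ
  set w := polarComponent u ρ θ φ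
  set h := swirlComponent u ρ θ φ
  have key := sphere_energy_algebra (s := sin θ) (c := cos θ) (κ := κ) (f := f) (w := w) (h := h)
    (r₁ := ρ * T (sphericalPoint θ φ) (sphericalPoint θ φ))
    (r₂ := ρ * T (sphericalPoint θ φ) (polarVector θ φ))
    (r₃ := ρ * T (sphericalPoint θ φ) (azimuthalVector φ))
    (p₁ := ρ * T (polarVector θ φ) (sphericalPoint θ φ))
    (p₂ := ρ * T (polarVector θ φ) (polarVector θ φ))
    (p₃ := ρ * T (polarVector θ φ) (azimuthalVector φ))
    (a₁ := ρ * T (azimuthalVector φ) (sphericalPoint θ φ))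
    (a₂ := ρ * T (azimuthalVector φ) (polarVector θ φ))
    (a₃ := ρ * T (azimuthalVector φ) (azimuthalVector φ)) hsin hκ0
    (by linear_combination e1) (by linear_combination (-ρ) * e2)
  -- The algebra supplies `2h²` for the swirl; only `2κ h²` is kept, to match the coefficient of
  -- `u_θ²`.
  have h0 : 0 ≤ 2 * (1 - κ) * h ^ 2 * sin θ := by
    have : 0 ≤ 1 - κ := by linarith
    positivity
  refine le_trans (le_of_eq ?_) ((sub_le_self _ h0).trans (key.trans (le_of_eq ?_))) <;> ring

/-- The Dirichlet integral on a sphere, for solenoidal fields with axisymmetric swirl. -/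
theorem integral_sphereForm_le (hu : ContDiff ℝ 1 u) (hdiv : IsSolenoidal u)
    (hs : HasAxisymmetricSwirl u) {κ : ℝ} (hκ0 : 0 ≤ κ) (hκ1 : κ ≤ 1) {ρ : ℝ} (hρ : 0 < ρ) :
    ∫ θ in (0)..π, ∫ φ in (-π)..π, sin θ * sphereForm u κ ρ θ φ
      ≤ ∫ θ in (0)..π, ∫ φ in (-π)..π,
          sin θ * (ρ ^ 2 * gradNormSq u (ρ • sphericalPoint θ φ)) := by
  have hd := hu.differentiable one_ne_zero
  have huc := hu.continuous
  have hπ : -π ≤ π := by linarith [pi_pos]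
  have h1 : ∫ θ in (0)..π, ∫ φ in (-π)..π, sin θ * sphereForm u κ ρ θ φ
      ≤ ∫ θ in (0)..π, ∫ φ in (-π)..π, meridianForm u κ ρ θ φ := by
    rw [intervalIntegral_swap (F := fun θ φ => sin θ * sphereForm u κ ρ θ φ)
        (by simp only [Function.uncurry_def]; fun_prop) pi_pos.le hπ,
      intervalIntegral_swap (F := fun θ φ => meridianForm u κ ρ θ φ)
        (by simp only [Function.uncurry_def]; fun_prop) pi_pos.le hπ]
    refine integral_mono_on hπ (Continuous.intervalIntegrable (by fun_prop) _ _)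
      (Continuous.intervalIntegrable (by fun_prop) _ _) fun φ _ => ?_
    exact integral_sphereForm_le_meridian hu hdiv hs κ hρ φ
  refine h1.trans (integral_mono_on_of_le_Ioo pi_pos.le
    (Continuous.intervalIntegrable (by fun_prop) _ _)
    (Continuous.intervalIntegrable (by fun_prop) _ _) fun θ hθ => ?_)
  refine (integral_mono_on hπ (Continuous.intervalIntegrable (by fun_prop) _ _)
    (Continuous.intervalIntegrable (by fun_prop) _ _)
    fun φ _ => meridianForm_le hu hdiv hs hκ0 hκ1 hρ hθ φ).trans_eq ?_
  rw [intervalIntegral.integral_add (Continuous.intervalIntegrable (by fun_prop) _ _)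
      (Continuous.intervalIntegrable (by fun_prop) _ _), intervalIntegral.integral_const_mul]
  simp only [hs.eq_zero_azimuth huc hρ.le (Ioo_subset_Icc_self hθ)]
  have hbd := intervalIntegral.integral_eq_sub_of_hasDerivAt (a := -π) (b := π)
    (fun φ _ => (((hasDerivAt_radialComponent_azimuth hd ρ θ φ).const_mul (sin θ)).add
      ((hasDerivAt_polarComponent_azimuth hd ρ θ φ).const_mul (cos θ))).const_mul
      (2 * swirlComponent u ρ θ 0))
    (Continuous.intervalIntegrable (by fun_prop) _ _)
  simp only [hs.eq_zero_azimuth huc hρ.le (Ioo_subset_Icc_self hθ)] at hbd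
  rw [intervalIntegral.integral_const_mul (1 / sin θ), hbd]
  simp [radialComponent, polarComponent, sphericalPoint, polarVector]

end Sphere

/-! ### Weighted inequalities along rays, then integrated over directions. -/

section Radial

variable {u : Space 3 → Space 3}

/-- Truncating the weight at `ε` makes it continuous on all of `ℝ`, so the integrands in `(ρ, θ, φ)`
are jointly continuous and the integrals can be exchanged. -/
theorem integral_rpow_eq_integral_max {ε R : ℝ} (hεR : ε ≤ R) (p : ℝ) (F : ℝ → ℝ) :
    ∫ ρ in ε..R, ρ ^ p * F ρ = ∫ ρ in ε..R, max ρ ε ^ p * F ρ := by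
  refine intervalIntegral.integral_congr fun ρ hρ => ?_
  rw [uIcc_of_le hεR] at hρ
  simp only [max_eq_left hρ.1]

theorem continuous_max_rpow {ε : ℝ} (hε : 0 < ε) (p : ℝ) {X : Type*}
    [TopologicalSpace X] {ρ : X → ℝ} (hρ : Continuous ρ) : Continuous fun x => max (ρ x) ε ^ p :=
  (hρ.max continuous_const).rpow_const fun _ => Or.inl (hε.trans_le (le_max_right _ _)).ne'

/-- The weighted one-dimensional inequality along a ray, with the boundary term at `ε`. -/
theorem integral_norm_sq_le_sphereForm (hu : ContDiff ℝ 1 u) {a κ ε R : ℝ} (hκ0 : 0 ≤ κ)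
    (hκ1 : κ ≤ 1) (hκ : κ * (2 + (a - 2) ^ 2) ≤ a ^ 2) (hε : 0 < ε) (hεR : ε ≤ R)
    (hR : ∀ x, R ≤ ‖x‖ → u x = 0) {θ : ℝ} (hθ : 0 ≤ sin θ) (φ : ℝ) :
    (a ^ 2 + 2 * κ) * ∫ ρ in ε..R,
        max ρ ε ^ (2 * a - 1) * (sin θ * ‖u (ρ • sphericalPoint θ φ)‖ ^ 2)
      ≤ (∫ ρ in ε..R, max ρ ε ^ (2 * a - 1) * (sin θ * sphereForm u κ ρ θ φ))
        + (2 + 2 * |a|) * (ε ^ (2 * a) * (sin θ * ‖u (ε • sphericalPoint θ φ)‖ ^ 2)) := by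
  have hd := hu.differentiable one_ne_zero
  have huc := hu.continuous
  have hW : Continuous fun ρ => max ρ ε ^ (2 * a - 1) := continuous_max_rpow hε _ continuous_id
  have hR0 : u (R • sphericalPoint θ φ) = 0 := hR _ (by
    rw [norm_smul, norm_sphericalPoint, mul_one]; exact le_abs_self R)
  -- `q` is the radial part of `sphereForm` minus `(a² + 2κ) u_ρ²`. The value of `c` makes the terms
  -- in `g * g'` combine into the square of `ρ g' + a g`; the remaining coefficient of `g²` is `a² -
  -- κ (2 + (a - 2)²)`, whence the condition on `κ`.
  have h1 := neg_boundary_le_integral_rpow (a := a) (c := -2 * κ - (2 - κ) * a)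
    (fun ρ => hasDerivAt_radialComponent_radial hd ρ θ φ)
    (q := fun ρ => (2 - κ) * (ρ * gradEntry u (ρ • sphericalPoint θ φ) (sphericalPoint θ φ)
        (sphericalPoint θ φ)) ^ 2
      - (a ^ 2 + 6 * κ) * radialComponent u ρ θ φ ^ 2
      - 4 * κ * (ρ * gradEntry u (ρ • sphericalPoint θ φ) (sphericalPoint θ φ)
        (sphericalPoint θ φ)) * radialComponent u ρ θ φ)
    (by fun_prop) hε hεR (by simp [radialComponent, hR0])
    (fun ρ => by
      set g := radialComponent u ρ θ φ
      set d := gradEntry u (ρ • sphericalPoint θ φ) (sphericalPoint θ φ) (sphericalPoint θ φ)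
      have e1 : 0 ≤ (2 - κ) * (ρ * d + a * g) ^ 2 := mul_nonneg (by linarith) (sq_nonneg _)
      have e2 : 0 ≤ (a ^ 2 - κ * (2 + (a - 2) ^ 2)) * g ^ 2 :=
        mul_nonneg (by linarith) (sq_nonneg _)
      linarith)
  -- For `u_θ` and `u_φ` the `2κ` is already present in `sphereForm`, so the classical Hardy
  -- inequality with constant `a²` is enough.
  have htan : ∀ (g g' : ℝ → ℝ), (∀ ρ, HasDerivAt g (g' ρ) ρ) → Continuous g' → g R = 0 →
      a * (ε ^ (2 * a) * g ε ^ 2)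
        ≤ ∫ ρ in ε..R, ρ ^ (2 * a - 1) * ((ρ * g' ρ) ^ 2 - a ^ 2 * g ρ ^ 2) := by
    intro g g' hg hg' hgR
    have hgc : Continuous g := continuous_iff_continuousAt.2 fun ρ => (hg ρ).continuousAt
    have := neg_boundary_le_integral_rpow (a := a) (c := -a) hg
      (q := fun ρ => (ρ * g' ρ) ^ 2 - a ^ 2 * g ρ ^ 2) (by fun_prop) hε hεR hgR
      (fun ρ => by linarith [sq_nonneg (ρ * g' ρ + a * g ρ)])
    linarith
  have h2 := htan _ _ (fun ρ => hasDerivAt_polarComponent_radial hd ρ θ φ) (by fun_prop)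
    (by simp [polarComponent, hR0])
  have h3 := htan _ _ (fun ρ => hasDerivAt_swirlComponent_radial hd ρ θ φ) (by fun_prop)
    (by simp [swirlComponent, hR0])
  rw [integral_rpow_eq_integral_max hεR] at h1 h2 h3
  have hsum := add_le_add (add_le_add h1 h2) h3
  rw [← intervalIntegral.integral_add (Continuous.intervalIntegrable (by fun_prop) _ _)
      (Continuous.intervalIntegrable (by fun_prop) _ _),
    ← intervalIntegral.integral_add (Continuous.intervalIntegrable (by fun_prop) _ _)
      (Continuous.intervalIntegrable (by fun_prop) _ _)] at hsum
  have hmul := mul_le_mul_of_nonneg_left hsum hθ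
  rw [← intervalIntegral.integral_const_mul] at hmul
  have hB : IntervalIntegrable (fun ρ => max ρ ε ^ (2 * a - 1) * (sin θ * sphereForm u κ ρ θ φ))
    volume ε R := Continuous.intervalIntegrable (by fun_prop) _ _
  have hA : IntervalIntegrable (fun ρ => (a ^ 2 + 2 * κ) *
    (max ρ ε ^ (2 * a - 1) * (sin θ * ‖u (ρ • sphericalPoint θ φ)‖ ^ 2)))
    volume ε R := Continuous.intervalIntegrable (by fun_prop) _ _
  have key := hmul.trans_eq ((intervalIntegral.integral_congr fun ρ _ => by
    simp only [norm_sq_eq_components, sphereForm]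
    ring).trans (intervalIntegral.integral_sub hB hA))
  rw [intervalIntegral.integral_const_mul] at key
  have hE : 0 ≤ ε ^ (2 * a) := rpow_nonneg hε.le _
  have hnn : ∀ x : ℝ, 0 ≤ sin θ * (ε ^ (2 * a) * x ^ 2) := fun x => by positivity
  -- Any bound independent of `ε` would do, since the boundary term tends to zero.
  have hc : -2 * κ - (2 - κ) * a ≤ 2 + 2 * |a| := by
    nlinarith [neg_abs_le a, abs_nonneg a]
  have hw : -a ≤ 2 + 2 * |a| := by linarith [neg_abs_le a, abs_nonneg a]
  have b1 := mul_le_mul_of_nonneg_right hc (hnn (radialComponent u ε θ φ))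
  have b2 := mul_le_mul_of_nonneg_right hw (hnn (polarComponent u ε θ φ))
  have b3 := mul_le_mul_of_nonneg_right hw (hnn (swirlComponent u ε θ φ))
  rw [norm_sq_eq_components]
  linarith

theorem integral_swap₃ {F : ℝ → ℝ → ℝ → ℝ} (hF : Continuous fun p : ℝ × ℝ × ℝ => F p.1 p.2.1 p.2.2)
    {a b c d e f : ℝ} (hab : a ≤ b) (hcd : c ≤ d) (hef : e ≤ f) :
    ∫ x in a..b, ∫ y in c..d, ∫ z in e..f, F x y z
      = ∫ y in c..d, ∫ z in e..f, ∫ x in a..b, F x y z := by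
  have hF' : ∀ {X : Type} [TopologicalSpace X] {x y z : X → ℝ}, Continuous x → Continuous y →
      Continuous z → Continuous fun p => F (x p) (y p) (z p) :=
    fun hx hy hz => hF.comp (hx.prodMk (hy.prodMk hz))
  rw [intervalIntegral_swap (F := fun x y => ∫ z in e..f, F x y z) _ hab hcd]
  · refine intervalIntegral.integral_congr fun y _ => ?_
    exact intervalIntegral_swap (F := fun x z => F x y z)
      (hF' continuous_fst continuous_const continuous_snd) hab hef
  · refine continuous_parametric_intervalIntegral_of_continuous' ?_ _ _
    exact hF' (by fun_prop) (by fun_prop) (by fun_prop)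

theorem continuous_integral_of_continuous₃ {F : ℝ → ℝ → ℝ → ℝ}
    (hF : Continuous fun p : ℝ × ℝ × ℝ => F p.1 p.2.1 p.2.2) (a b : ℝ) :
    Continuous (Function.uncurry fun y z => ∫ x in a..b, F x y z) :=
  continuous_parametric_intervalIntegral_of_continuous' (f := fun (p : ℝ × ℝ) x => F x p.1 p.2)
    (hF.comp (continuous_snd.prodMk continuous_fst)) _ _

theorem integral₂_mono_affine {I₁ I₂ I₃ : ℝ → ℝ → ℝ} (h₁ : Continuous (Function.uncurry I₁))
    (h₂ : Continuous (Function.uncurry I₂)) (h₃ : Continuous (Function.uncurry I₃))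
    {a b c d : ℝ} (hab : a ≤ b) (hcd : c ≤ d) (C K : ℝ)
    (h : ∀ x ∈ Icc a b, ∀ y, C * I₁ x y ≤ I₂ x y + K * I₃ x y) :
    C * ∫ x in a..b, ∫ y in c..d, I₁ x y
      ≤ (∫ x in a..b, ∫ y in c..d, I₂ x y) + K * ∫ x in a..b, ∫ y in c..d, I₃ x y := by
  have hpar : ∀ {F : ℝ → ℝ → ℝ}, Continuous (Function.uncurry F) →
      IntervalIntegrable (fun x => ∫ y in c..d, F x y) volume a b := fun hF =>
    (continuous_parametric_intervalIntegral_of_continuous' hF _ _).intervalIntegrable _ _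
  have hsec : ∀ {F : ℝ → ℝ → ℝ}, Continuous (Function.uncurry F) → ∀ x,
      IntervalIntegrable (fun y => F x y) volume c d := fun hF x =>
    Continuous.intervalIntegrable (hF.comp (continuous_const.prodMk continuous_id)) _ _
  rw [← intervalIntegral.integral_const_mul, ← intervalIntegral.integral_const_mul,
    ← intervalIntegral.integral_add (hpar h₂) ((hpar h₃).const_mul K)]
  refine integral_mono_on hab ((hpar h₁).const_mul C) ((hpar h₂).add ((hpar h₃).const_mul K))
    fun x hx => ?_
  rw [← intervalIntegral.integral_const_mul, ← intervalIntegral.integral_const_mul,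
    ← intervalIntegral.integral_add (hsec h₂ x) ((hsec h₃ x).const_mul K)]
  exact integral_mono_on hcd ((hsec h₁ x).const_mul C)
    ((hsec h₂ x).add ((hsec h₃ x).const_mul K)) fun y _ => h x hx y

/-- The integral of `q` over the sphere of radius `ρ`, with respect to the solid angle. -/
noncomputable def solidAngleIntegral (q : Space 3 → ℝ) (ρ : ℝ) : ℝ :=
  ∫ θ in (0)..π, ∫ φ in (-π)..π, sin θ * q (ρ • sphericalPoint θ φ)

theorem continuous_solidAngleIntegral {q : Space 3 → ℝ} (hq : Continuous q) :
    Continuous (solidAngleIntegral q) := by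
  unfold solidAngleIntegral
  fun_prop

theorem solidAngleIntegral_mono {p q : Space 3 → ℝ} (hp : Continuous p) (hq : Continuous q)
    {r s : ℝ} (h : ∀ θ φ, p (r • sphericalPoint θ φ) ≤ q (s • sphericalPoint θ φ)) :
    solidAngleIntegral p r ≤ solidAngleIntegral q s := by
  have hπ : -π ≤ π := by linarith [pi_pos]
  refine integral_mono_on pi_pos.le (Continuous.intervalIntegrable (by fun_prop) _ _)
    (Continuous.intervalIntegrable (by fun_prop) _ _) fun θ hθ => ?_
  exact integral_mono_on hπ (Continuous.intervalIntegrable (by fun_prop) _ _)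
    (Continuous.intervalIntegrable (by fun_prop) _ _) fun φ _ =>
    mul_le_mul_of_nonneg_left (h θ φ) (sin_nonneg_of_mem_Icc hθ)

theorem solidAngleIntegral_nonneg {q : Space 3 → ℝ} (hq : ∀ x, 0 ≤ q x) (ρ : ℝ) :
    0 ≤ solidAngleIntegral q ρ :=
  integral_nonneg pi_pos.le fun θ hθ => integral_nonneg (by linarith [pi_pos]) fun φ _ =>
    mul_nonneg (sin_nonneg_of_mem_Icc hθ) (hq _)

theorem integral_rpow_sphereForm_le (hu : ContDiff ℝ 1 u) (hdiv : IsSolenoidal u)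
    (hs : HasAxisymmetricSwirl u) {κ ε R : ℝ} (p : ℝ) (hκ0 : 0 ≤ κ) (hκ1 : κ ≤ 1) (hε : 0 < ε)
    (hεR : ε ≤ R) :
    ∫ ρ in ε..R, max ρ ε ^ p * ∫ θ in (0)..π, ∫ φ in (-π)..π, sin θ * sphereForm u κ ρ θ φ
      ≤ ∫ ρ in ε..R, max ρ ε ^ p * (ρ ^ 2 * solidAngleIntegral (gradNormSq u) ρ) := by
  have hsc := continuous_solidAngleIntegral (q := gradNormSq u) (by fun_prop)
  have hW := continuous_max_rpow hε p continuous_id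
  refine integral_mono_on hεR (Continuous.intervalIntegrable (hW.mul (by fun_prop)) _ _)
    (Continuous.intervalIntegrable (hW.mul (by fun_prop)) _ _) fun ρ hρ => ?_
  refine mul_le_mul_of_nonneg_left ?_ (rpow_nonneg (hε.le.trans (le_max_right _ _)) _)
  refine (integral_sphereForm_le hu hdiv hs hκ0 hκ1 (hε.trans_le hρ.1)).trans_eq ?_
  simp only [solidAngleIntegral, ← intervalIntegral.integral_const_mul, mul_left_comm]

/-- The weighted inequality outside the ball of radius `ε`. -/
theorem integral_solidAngleIntegral_le (hu : ContDiff ℝ 1 u) (hdiv : IsSolenoidal u)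
    (hs : HasAxisymmetricSwirl u) {a κ ε R : ℝ} (hκ0 : 0 ≤ κ)
    (hκ1 : κ ≤ 1) (hκ : κ * (2 + (a - 2) ^ 2) ≤ a ^ 2) (hε : 0 < ε) (hεR : ε ≤ R)
    (hR : ∀ x, R ≤ ‖x‖ → u x = 0) :
    (a ^ 2 + 2 * κ) * ∫ ρ in ε..R, ρ ^ (2 * a - 1) * solidAngleIntegral (fun x => ‖u x‖ ^ 2) ρ
      ≤ (∫ ρ in ε..R, ρ ^ (2 * a - 1) * (ρ ^ 2 * solidAngleIntegral (gradNormSq u) ρ))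
        + (2 + 2 * |a|) * (ε ^ (2 * a) * solidAngleIntegral (fun x => ‖u x‖ ^ 2) ε) := by
  have huc := hu.continuous
  have hπ : -π ≤ π := by linarith [pi_pos]
  have hW : Continuous fun p : ℝ × ℝ × ℝ => max p.1 ε ^ (2 * a - 1) :=
    continuous_max_rpow hε _ continuous_fst
  have hcF : Continuous fun p : ℝ × ℝ × ℝ =>
      max p.1 ε ^ (2 * a - 1) * (sin p.2.1 * ‖u (p.1 • sphericalPoint p.2.1 p.2.2)‖ ^ 2) :=
    hW.mul (by fun_prop)
  have hcS : Continuous fun p : ℝ × ℝ × ℝ =>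
      max p.1 ε ^ (2 * a - 1) * (sin p.2.1 * sphereForm u κ p.1 p.2.1 p.2.2) :=
    hW.mul (by fun_prop)
  set F : ℝ → ℝ → ℝ → ℝ := fun ρ θ φ =>
    max ρ ε ^ (2 * a - 1) * (sin θ * ‖u (ρ • sphericalPoint θ φ)‖ ^ 2) with hF
  set S : ℝ → ℝ → ℝ → ℝ := fun ρ θ φ =>
    max ρ ε ^ (2 * a - 1) * (sin θ * sphereForm u κ ρ θ φ) with hS
  have e1 := integral_swap₃ (F := F) hcF hεR pi_pos.le hπ
  have e2 := integral_swap₃ (F := S) hcS hεR pi_pos.le hπ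
  have key := integral₂_mono_affine (continuous_integral_of_continuous₃ (F := F) hcF ε R)
    (continuous_integral_of_continuous₃ (F := S) hcS ε R)
    (I₃ := fun θ φ => ε ^ (2 * a) * (sin θ * ‖u (ε • sphericalPoint θ φ)‖ ^ 2))
    (by simp only [Function.uncurry_def]; fun_prop) pi_pos.le hπ (a ^ 2 + 2 * κ) (2 + 2 * |a|)
    fun θ hθ φ => integral_norm_sq_le_sphereForm hu hκ0 hκ1 hκ hε hεR hR
      (sin_nonneg_of_mem_Icc hθ) φ
  rw [← e1, ← e2] at key
  simp only [hF, hS, intervalIntegral.integral_const_mul (max _ ε ^ (2 * a - 1)),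
    intervalIntegral.integral_const_mul (ε ^ (2 * a))] at key
  rw [integral_rpow_eq_integral_max hεR, integral_rpow_eq_integral_max hεR]
  exact key.trans (add_le_add (integral_rpow_sphereForm_le hu hdiv hs _ hκ0 hκ1 hε hεR) le_rfl)

end Radial

/-! ### The boundary term at the origin. -/

section Boundary

/-- Cauchy–Schwarz, obtained from the nonnegativity of the variance of `g'` around its mean `g ε /
ε`. -/
theorem sq_le_mul_integral_deriv_sq {g g' : ℝ → ℝ} (hg : ∀ s, HasDerivAt g (g' s) s)
    (hg' : Continuous g') (h0 : g 0 = 0) {ε : ℝ} (hε : 0 < ε) :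
    g ε ^ 2 ≤ ε * ∫ s in (0)..ε, g' s ^ 2 := by
  have h1 : 0 ≤ ∫ s in (0)..ε, (g' s - g ε / ε) ^ 2 :=
    integral_nonneg hε.le fun s _ => sq_nonneg _
  have h2 : ∫ s in (0)..ε, g' s = g ε := by
    rw [integral_eq_sub_of_hasDerivAt (fun s _ => hg s) (hg'.intervalIntegrable _ _), h0, sub_zero]
  have h3 : ∀ s, (g' s - g ε / ε) ^ 2 = g' s ^ 2 - 2 * (g ε / ε) * g' s + (g ε / ε) ^ 2 :=
    fun s => by ring
  simp only [h3] at h1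
  rw [intervalIntegral.integral_add (Continuous.intervalIntegrable (by fun_prop) _ _)
      (Continuous.intervalIntegrable (by fun_prop) _ _),
    intervalIntegral.integral_sub (Continuous.intervalIntegrable (by fun_prop) _ _)
      (Continuous.intervalIntegrable (by fun_prop) _ _), intervalIntegral.integral_const_mul, h2,
    intervalIntegral.integral_const] at h1
  have h4 := mul_nonneg hε.le h1
  have h5 : ε * ((∫ s in (0)..ε, g' s ^ 2) - 2 * (g ε / ε) * g ε + (ε - 0) • (g ε / ε) ^ 2)
      = ε * (∫ s in (0)..ε, g' s ^ 2) - g ε ^ 2 := by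
    simp only [smul_eq_mul]
    field_simp
    ring
  linarith

variable {u : Space 3 → Space 3}

theorem norm_sq_le_mul_integral_gradNormSq (hu : ContDiff ℝ 1 u) (h0 : u 0 = 0) {ε : ℝ}
    (hε : 0 < ε) (θ φ : ℝ) : ‖u (ε • sphericalPoint θ φ)‖ ^ 2
      ≤ ε * ∫ s in (0)..ε, gradNormSq u (s • sphericalPoint θ φ) := by
  have hd := hu.differentiable one_ne_zero
  have h1 := sq_le_mul_integral_deriv_sq
    (fun ρ => hasDerivAt_radialComponent_radial hd ρ θ φ) (by fun_prop)
    (by simp [radialComponent, h0]) hε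
  have h2 := sq_le_mul_integral_deriv_sq
    (fun ρ => hasDerivAt_polarComponent_radial hd ρ θ φ) (by fun_prop)
    (by simp [polarComponent, h0]) hε
  have h3 := sq_le_mul_integral_deriv_sq
    (fun ρ => hasDerivAt_swirlComponent_radial hd ρ θ φ) (by fun_prop)
    (by simp [swirlComponent, h0]) hε
  rw [norm_sq_eq_components]
  refine (add_le_add (add_le_add h1 h2) h3).trans ?_
  rw [← mul_add, ← mul_add,
    ← intervalIntegral.integral_add (Continuous.intervalIntegrable (by fun_prop) _ _)
      (Continuous.intervalIntegrable (by fun_prop) _ _),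
    ← intervalIntegral.integral_add (Continuous.intervalIntegrable (by fun_prop) _ _)
      (Continuous.intervalIntegrable (by fun_prop) _ _)]
  refine mul_le_mul_of_nonneg_left (integral_mono_on hε.le
    (Continuous.intervalIntegrable (by fun_prop) _ _)
    (Continuous.intervalIntegrable (by fun_prop) _ _) fun s _ => ?_) hε.le
  rw [gradNormSq_eq_frame u _ θ φ, norm_sq_eq_frame (fderiv ℝ u _ (sphericalPoint θ φ)) θ φ]
  simp only [gradEntry, add_assoc]
  gcongr
  exact le_add_of_nonneg_right (by positivity)

theorem solidAngleIntegral_norm_sq_le (hu : ContDiff ℝ 1 u) (h0 : u 0 = 0) {ε : ℝ} (hε : 0 < ε) :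
    solidAngleIntegral (fun x => ‖u x‖ ^ 2) ε
      ≤ ε * ∫ s in (0)..ε, solidAngleIntegral (gradNormSq u) s := by
  have huc := hu.continuous
  have hπ : -π ≤ π := by linarith [pi_pos]
  have hc : Continuous fun p : ℝ × ℝ × ℝ =>
      sin p.2.1 * gradNormSq u (p.1 • sphericalPoint p.2.1 p.2.2) := by fun_prop
  have e := integral_swap₃ (F := fun s θ φ => sin θ * gradNormSq u (s • sphericalPoint θ φ)) hc
    hε.le pi_pos.le hπ
  simp only [solidAngleIntegral]
  rw [e]
  have hpar := continuous_integral_of_continuous₃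
    (F := fun s θ φ => sin θ * gradNormSq u (s • sphericalPoint θ φ)) hc 0 ε
  have hsq : Continuous (Function.uncurry fun θ φ => sin θ * ‖u (ε • sphericalPoint θ φ)‖ ^ 2) := by
    simp only [Function.uncurry_def]
    fun_prop
  have key := integral₂_mono_affine (I₂ := fun _ _ => 0) hsq continuous_const hpar pi_pos.le hπ 1 ε
    fun θ hθ φ => by
      rw [intervalIntegral.integral_const_mul, one_mul, zero_add, mul_left_comm]
      exact mul_le_mul_of_nonneg_left
        (norm_sq_le_mul_integral_gradNormSq hu h0 hε θ φ) (sin_nonneg_of_mem_Icc hθ)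
  simp only [one_mul, intervalIntegral.integral_zero, zero_add] at key
  exact key

theorem gradNormSq_nonneg (u : Space 3 → Space 3) (x : Space 3) : 0 ≤ gradNormSq u x :=
  Finset.sum_nonneg fun _ _ => Finset.sum_nonneg fun _ _ => sq_nonneg _

/-- The boundary term at the origin vanishes, for fields of finite energy that vanish at the origin
if `a ≤ 0`. -/
theorem tendsto_boundary (hu : ContDiff ℝ 1 u) (hsupp : HasCompactSupport u) {a : ℝ}
    (h0 : a ≤ 0 → u 0 = 0)
    (hfin : ∫⁻ ρ in Ioi (0 : ℝ), ENNReal.ofReal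
      (ρ ^ (2 * a - 1) * (ρ ^ 2 * solidAngleIntegral (gradNormSq u) ρ)) ≠ ⊤) :
    Tendsto (fun ε => ENNReal.ofReal (ε ^ (2 * a) * solidAngleIntegral (fun x => ‖u x‖ ^ 2) ε))
      (𝓝[>] 0) (𝓝 0) := by
  have huc := hu.continuous
  have hmc := continuous_solidAngleIntegral (q := fun x => ‖u x‖ ^ 2) (by fun_prop)
  have hgc := continuous_solidAngleIntegral (q := gradNormSq u) (by fun_prop)
  have hid : Tendsto (fun ε : ℝ => ε) (𝓝[>] 0) (𝓝 0) := nhdsWithin_le_nhds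
  have hpow : ∀ {p : ℝ}, 0 < p → Tendsto (fun ε : ℝ => ε ^ p) (𝓝[>] 0) (𝓝 0) := fun {p} hp => by
    simpa [zero_rpow hp.ne'] using hid.rpow_const (Or.inr hp.le)
  -- For `a > 0` the power `ε^(2a)` suffices. For `-1/2 < a ≤ 0`, `u 0 = 0` and the Lipschitz bound
  -- give order `ε^(2a+2)`. For `a ≤ -1/2` the power `s^(2a+1)` is nonincreasing, so the boundary
  -- term is at most the energy in the ball of radius `ε`, a tail of a convergent integral.
  rcases lt_or_ge 0 a with ha | ha
  · rw [← ENNReal.ofReal_zero]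
    refine ENNReal.tendsto_ofReal ?_
    simpa using (hpow (by linarith : 0 < 2 * a)).mul ((hmc.tendsto 0).comp hid)
  rcases lt_or_ge (-(1 / 2)) a with ha' | ha'
  · obtain ⟨L, hL⟩ := hu.lipschitzWith_of_hasCompactSupport hsupp one_ne_zero
    have hlip : ∀ x, ‖u x‖ ≤ L * ‖x‖ := fun x => by
      simpa [h0 ha] using hL.dist_le_mul x 0
    have hb : ∀ ε, 0 < ε → solidAngleIntegral (fun x => ‖u x‖ ^ 2) ε
        ≤ ε ^ 2 * solidAngleIntegral (fun _ => (L : ℝ) ^ 2) 0 := by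
      intro ε hε
      have : ε ^ 2 * solidAngleIntegral (fun _ => (L : ℝ) ^ 2) 0
          = solidAngleIntegral (fun _ => ε ^ 2 * (L : ℝ) ^ 2) 0 := by
        simp only [solidAngleIntegral, ← intervalIntegral.integral_const_mul, mul_left_comm]
      rw [this]
      refine solidAngleIntegral_mono (by fun_prop) (by fun_prop) fun θ φ => ?_
      have h := hlip (ε • sphericalPoint θ φ)
      rw [norm_smul, norm_sphericalPoint, mul_one, norm_of_nonneg hε.le] at h
      rw [← mul_pow, mul_comm ε]
      gcongr
    rw [← ENNReal.ofReal_zero]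
    refine ENNReal.tendsto_ofReal ?_
    have hlim : Tendsto (fun ε : ℝ => ε ^ (2 * a + 2)
        * solidAngleIntegral (fun _ => (L : ℝ) ^ 2) 0) (𝓝[>] 0) (𝓝 0) := by
      simpa using (hpow (by linarith : 0 < 2 * a + 2)).mul_const _
    refine squeeze_zero' ?_ ?_ hlim
    · filter_upwards [self_mem_nhdsWithin] with ε hε
      exact mul_nonneg (rpow_nonneg (le_of_lt hε) _)
        (solidAngleIntegral_nonneg (fun _ => sq_nonneg _) _)
    · filter_upwards [self_mem_nhdsWithin] with ε hε
      have hε : 0 < ε := hε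
      rw [rpow_add hε, rpow_two, mul_assoc]
      exact mul_le_mul_of_nonneg_left (hb ε hε) (rpow_nonneg hε.le _)
  · have htail : Tendsto (fun ε => ∫⁻ ρ in Ioo 0 ε, ENNReal.ofReal
        (ρ ^ (2 * a - 1) * (ρ ^ 2 * solidAngleIntegral (gradNormSq u) ρ))
          ∂(volume.restrict (Ioi (0 : ℝ)))) (𝓝[>] 0) (𝓝 0) := by
      refine tendsto_setLIntegral_zero hfin ?_
      have : Tendsto (fun ε : ℝ => volume (Ioo 0 ε)) (𝓝[>] 0) (𝓝 0) := by
        simp only [Real.volume_Ioo, sub_zero]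
        simpa using ENNReal.tendsto_ofReal hid
      exact tendsto_of_tendsto_of_tendsto_of_le_of_le tendsto_const_nhds this (fun _ => zero_le)
        fun _ => Measure.restrict_apply_le _ _
    refine tendsto_of_tendsto_of_tendsto_of_le_of_le' tendsto_const_nhds htail
      (Eventually.of_forall fun _ => zero_le) ?_
    filter_upwards [self_mem_nhdsWithin] with ε hε
    have hε : 0 < ε := hε
    have hE : 0 ≤ ε ^ (2 * a + 1) := rpow_nonneg hε.le _
    rw [Measure.restrict_restrict measurableSet_Ioo, inter_eq_self_of_subset_left
      Ioo_subset_Ioi_self]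
    calc ENNReal.ofReal (ε ^ (2 * a) * solidAngleIntegral (fun x => ‖u x‖ ^ 2) ε)
        ≤ ENNReal.ofReal (∫ s in (0)..ε, ε ^ (2 * a + 1) * solidAngleIntegral (gradNormSq u) s) := by
          refine ENNReal.ofReal_le_ofReal ?_
          rw [intervalIntegral.integral_const_mul, rpow_add_one hε.ne', mul_assoc]
          exact mul_le_mul_of_nonneg_left (solidAngleIntegral_norm_sq_le hu (h0 ha) hε)
            (rpow_nonneg hε.le _)
      _ = ∫⁻ s in Ioo 0 ε, ENNReal.ofReal
            (ε ^ (2 * a + 1) * solidAngleIntegral (gradNormSq u) s) :=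
          (setLIntegral_Ioo_ofReal (by fun_prop) hε.le fun s _ =>
            mul_nonneg hE (solidAngleIntegral_nonneg (gradNormSq_nonneg u) s)).symm
      _ ≤ _ := by
          refine setLIntegral_mono' measurableSet_Ioo fun s hs => ENNReal.ofReal_le_ofReal ?_
          rw [← mul_assoc, ← rpow_two, ← rpow_add hs.1]
          refine mul_le_mul_of_nonneg_right ?_ (solidAngleIntegral_nonneg (gradNormSq_nonneg u) s)
          rw [show 2 * a - 1 + 2 = 2 * a + 1 by ring]
          exact rpow_le_rpow_of_nonpos hs.1 hs.2.le (by linarith)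

end Boundary

/-! ### The limit `ε → 0` and the theorem. -/

/-- The Hardy–Leray inequality in spherical coordinates. -/
theorem lintegral_solidAngleIntegral_le {u : Space 3 → Space 3} (hu : ContDiff ℝ 1 u)
    (hsupp : HasCompactSupport u) (hdiv : IsSolenoidal u) (hs : HasAxisymmetricSwirl u) {a κ : ℝ}
    (h0 : a ≤ 0 → u 0 = 0) (hκ0 : 0 ≤ κ) (hκ1 : κ ≤ 1) (hκ : κ * (2 + (a - 2) ^ 2) ≤ a ^ 2) :
    ENNReal.ofReal (a ^ 2 + 2 * κ) * ∫⁻ ρ in Ioi (0 : ℝ), ENNReal.ofReal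
        (ρ ^ (2 * a - 1) * solidAngleIntegral (fun x => ‖u x‖ ^ 2) ρ)
      ≤ ∫⁻ ρ in Ioi (0 : ℝ), ENNReal.ofReal
        (ρ ^ (2 * a - 1) * (ρ ^ 2 * solidAngleIntegral (gradNormSq u) ρ)) := by
  have huc := hu.continuous
  have hmc := continuous_solidAngleIntegral (q := fun x => ‖u x‖ ^ 2) (by fun_prop)
  have hgc := continuous_solidAngleIntegral (q := gradNormSq u) (by fun_prop)
  set M : ℝ → ℝ := fun ρ => ρ ^ (2 * a - 1) * solidAngleIntegral (fun x => ‖u x‖ ^ 2) ρ with hM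
  set E : ℝ → ℝ := fun ρ => ρ ^ (2 * a - 1) * (ρ ^ 2 * solidAngleIntegral (gradNormSq u) ρ) with hE
  rcases eq_or_ne (∫⁻ ρ in Ioi (0 : ℝ), ENNReal.ofReal (E ρ)) ⊤ with hfin | hfin
  · rw [hfin]; exact le_top
  obtain ⟨R, hRpos, hR⟩ : ∃ R > 0, ∀ x, R ≤ ‖x‖ → u x = 0 := by
    obtain ⟨R, hRpos, hR⟩ := hsupp.isCompact.isBounded.subset_ball_lt 0 (0 : Space 3)
    refine ⟨R, hRpos, fun x hx => image_eq_zero_of_notMem_tsupport fun h => ?_⟩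
    have := hR h
    rw [mem_ball_zero_iff] at this
    linarith
  have hpow : ∀ {ε : ℝ}, 0 < ε → ContinuousOn (fun ρ : ℝ => ρ ^ (2 * a - 1)) (Icc ε R) :=
    fun hε ρ hρ =>
      (continuousAt_rpow_const _ _ (Or.inl (hε.trans_le hρ.1).ne')).continuousWithinAt
  have hM0 : ∀ ρ, 0 < ρ → 0 ≤ M ρ := fun ρ hρ =>
    mul_nonneg (rpow_nonneg hρ.le _) (solidAngleIntegral_nonneg (fun _ => sq_nonneg _) _)
  have hE0 : ∀ ρ, 0 < ρ → 0 ≤ E ρ := fun ρ hρ => mul_nonneg (rpow_nonneg hρ.le _)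
    (mul_nonneg (sq_nonneg _) (solidAngleIntegral_nonneg (gradNormSq_nonneg u) _))
  have hset : ∀ {F : ℝ → ℝ} {ε : ℝ}, 0 < ε → ε ≤ R → ContinuousOn F (Icc ε R) →
      (∀ ρ, 0 < ρ → 0 ≤ F ρ) →
      ENNReal.ofReal (∫ ρ in ε..R, F ρ) = ∫⁻ ρ in Ioo ε R, ENNReal.ofReal (F ρ) := by
    intro F ε hε hεR hF hF0
    rw [integral_of_le hεR, integral_Ioc_eq_integral_Ioo, ofReal_integral_eq_lintegral_ofReal]
    · exact (hF.integrableOn_Icc).mono_set Ioo_subset_Icc_self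
    · exact (ae_restrict_iff' measurableSet_Ioo).2
        (Eventually.of_forall fun ρ hρ => hF0 ρ (hε.trans hρ.1))
  have hvanish : ∫⁻ ρ in Ioi (0 : ℝ), ENNReal.ofReal (M ρ)
      = ∫⁻ ρ in Ioo 0 R, ENNReal.ofReal (M ρ) := by
    rw [← lintegral_inter_add_sdiff _ _ (measurableSet_Ioo : MeasurableSet (Ioo 0 R)),
      inter_eq_self_of_subset_right Ioo_subset_Ioi_self,
      setLIntegral_eq_zero (s := Ioi 0 \ Ioo 0 R) (measurableSet_Ioi.diff measurableSet_Ioo),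
      add_zero]
    intro ρ hρ
    have hρ0 : 0 < ρ := hρ.1
    have hρR : R ≤ ρ := not_lt.1 fun h => hρ.2 ⟨hρ0, h⟩
    have : ∀ θ φ, u (ρ • sphericalPoint θ φ) = 0 := fun θ φ => hR _ (by
      rwa [norm_smul, norm_sphericalPoint, mul_one, norm_of_nonneg hρ0.le])
    simp [hM, solidAngleIntegral, this]
  have hbox : ∀ᶠ ε in 𝓝[>] (0 : ℝ), ENNReal.ofReal (a ^ 2 + 2 * κ) *
      ∫⁻ ρ in Ioo ε R, ENNReal.ofReal (M ρ) ∂(volume.restrict (Ioo 0 R))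
      ≤ (∫⁻ ρ in Ioi (0 : ℝ), ENNReal.ofReal (E ρ)) + ENNReal.ofReal (2 + 2 * |a|) *
        ENNReal.ofReal (ε ^ (2 * a) * solidAngleIntegral (fun x => ‖u x‖ ^ 2) ε) := by
    filter_upwards [Ioo_mem_nhdsGT hRpos] with ε hε
    rw [Measure.restrict_restrict measurableSet_Ioo,
      inter_eq_self_of_subset_left (Ioo_subset_Ioo_left hε.1.le),
      ← hset (F := M) hε.1 hε.2.le ((hpow hε.1).mul hmc.continuousOn) hM0,
      ← ENNReal.ofReal_mul (by positivity), ← ENNReal.ofReal_mul (by positivity)]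
    refine (ENNReal.ofReal_le_ofReal (integral_solidAngleIntegral_le hu hdiv hs hκ0 hκ1 hκ hε.1
      hε.2.le hR)).trans (ENNReal.ofReal_add_le.trans (add_le_add ?_ le_rfl))
    rw [hset (F := E) hε.1 hε.2.le ((hpow hε.1).mul (by fun_prop)) hE0]
    exact lintegral_mono_set fun ρ hρ => hε.1.trans hρ.1
  have hMm : AEMeasurable (fun ρ => ENNReal.ofReal (M ρ)) (volume.restrict (Ioo 0 R)) := by
    refine Measurable.aemeasurable ?_
    have := hmc.measurable
    fun_prop
  have hcover : AECover (volume.restrict (Ioo 0 R)) (𝓝[>] (0 : ℝ)) fun ε => Ioo ε R :=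
    aecover_Ioo_of_Ioo (nhdsWithin_le_nhds : Tendsto (fun ε : ℝ => ε) (𝓝[>] 0) (𝓝 0))
      tendsto_const_nhds
  have hlhs := ENNReal.Tendsto.const_mul (a := ENNReal.ofReal (a ^ 2 + 2 * κ))
    (hcover.lintegral_tendsto_of_countably_generated hMm) (Or.inr ENNReal.ofReal_ne_top)
  have hrhs := (ENNReal.Tendsto.const_mul (a := ENNReal.ofReal (2 + 2 * |a|))
    (tendsto_boundary hu hsupp h0 hfin) (Or.inr ENNReal.ofReal_ne_top)).const_add
    (∫⁻ ρ in Ioi (0 : ℝ), ENNReal.ofReal (E ρ))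
  rw [mul_zero, add_zero] at hrhs
  rw [hvanish]
  exact le_of_tendsto_of_tendsto hlhs hrhs hbox

end HardyLeray

/-- The integrals are Lebesgue integrals of nonnegative functions, with values in `[0, ∞]`. -/
theorem corollary3 (γ : ℝ) (u : HardyLeray.Space 3 → HardyLeray.Space 3)
    (hu : HardyLeray.IsTestField 3 γ u)
    (hdiv : HardyLeray.IsSolenoidal u)
    (hswirl : HardyLeray.HasAxisymmetricSwirl u) :
    ENNReal.ofReal (HardyLeray.costinMazyaConst γ) *
        ∫⁻ x : HardyLeray.Space 3, ENNReal.ofReal (‖u x‖ ^ 2 / ‖x‖ ^ 2 * ‖x‖ ^ (2 * γ)) ≤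
      ∫⁻ x : HardyLeray.Space 3, ENNReal.ofReal (HardyLeray.gradNormSq u x * ‖x‖ ^ (2 * γ)) := by
  have hu1 : ContDiff ℝ 1 u := hu.smooth.of_le (by norm_cast)
  have huc := hu1.continuous
  -- `κ` is the minimum of 1 and `a² / (2 + (a - 2)²)` with `a = γ + 1/2`; the quotient is at most 1
  -- exactly when `a ≤ 3/2`, i.e. `γ ≤ 1`.
  obtain ⟨κ, hκ0, hκ1, hκ, hC⟩ : ∃ κ : ℝ, 0 ≤ κ ∧ κ ≤ 1 ∧
      κ * (2 + ((γ + 1 / 2) - 2) ^ 2) ≤ (γ + 1 / 2) ^ 2 ∧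
      HardyLeray.costinMazyaConst γ = (γ + 1 / 2) ^ 2 + 2 * κ := by
    have hpos : 0 < 2 + (γ - 3 / 2) ^ 2 := by positivity
    by_cases h : γ ≤ 1
    · refine ⟨(γ + 1 / 2) ^ 2 / (2 + (γ - 3 / 2) ^ 2), by positivity, ?_, ?_, ?_⟩
      · rw [div_le_one hpos]
        nlinarith
      · rw [show γ + 1 / 2 - 2 = γ - 3 / 2 by ring, div_mul_cancel₀ _ hpos.ne']
      · rw [HardyLeray.costinMazyaConst, if_pos h]
        field_simp
        ring
    · refine ⟨1, zero_le_one, le_rfl, ?_, ?_⟩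
      · nlinarith
      · rw [HardyLeray.costinMazyaConst, if_neg h, mul_one]
  have hlhs : ∫⁻ x : HardyLeray.Space 3, ENNReal.ofReal (‖u x‖ ^ 2 / ‖x‖ ^ 2 * ‖x‖ ^ (2 * γ))
      = ∫⁻ x : HardyLeray.Space 3, ENNReal.ofReal (‖u x‖ ^ 2 * ‖x‖ ^ (2 * γ - 2)) := by
    -- The two integrands may differ at the origin, where the quotient is a division by zero.
    refine lintegral_congr_ae ?_
    filter_upwards [Measure.ae_ne volume (0 : HardyLeray.Space 3)] with x hx
    have hx0 : 0 < ‖x‖ := norm_pos_iff.2 hx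
    rw [Real.rpow_sub hx0, Real.rpow_two]
    congr 1
    ring
  rw [hlhs, HardyLeray.lintegral_mul_norm_rpow _ (by fun_prop) (fun _ => sq_nonneg _),
    HardyLeray.lintegral_mul_norm_rpow _ (by fun_prop) (HardyLeray.gradNormSq_nonneg u), hC]
  refine (le_of_eq ?_).trans ((HardyLeray.lintegral_solidAngleIntegral_le hu1 hu.compactSupport
    hdiv hswirl (a := γ + 1 / 2) (fun ha => hu.zero_at_origin (by push_cast; linarith)) hκ0 hκ1
    hκ).trans (le_of_eq ?_))
  · congr 1
    refine setLIntegral_congr_fun measurableSet_Ioi fun ρ _ => ?_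
    rw [show 2 * γ - 2 + 2 = 2 * (γ + 1 / 2) - 1 by ring]
    rfl
  · refine setLIntegral_congr_fun measurableSet_Ioi fun ρ hρ => ?_
    rw [← mul_assoc, ← Real.rpow_two, ← Real.rpow_add hρ,
      show 2 * (γ + 1 / 2) - 1 + 2 = 2 * γ + 2 by ring]
    rfl
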